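/- Let $n\ge 2$ and let $\mathcal K^n$ be the space of (nonempty, compact) convex bodies in $\mathbb R^n$ with the Hausdorff metric and its Borel $\sigma$-algebra. Let $\mathrm{Val}$ be the class of continuous, translation invariant functions $\varphi:\mathcal K^n\to\mathbb R$ with $\varphi(K\cup M)+\varphi(K\cap M)=\varphi(K)+\varphi(M)$ whenever $K,M,K\cup M\in\mathcal K^n$. Every $\varphi\in\mathrm{Val}$ has a unique additive extension, again denoted by $\varphi$, to the finite unions of convex bodies (polyconvex sets), with $\varphi(\emptyset)=0$. Let $\{\xi_1,\xi_2,\dots\}$ be a (measurably enumerated) stationary Poisson process in $\mathbb R^n$ of intensity $\gamma>0$: the points are almost surely distinct, the number of points in a bounded Borel set $A$ is Poisson distributed with parameter $\gamma\lambda_n(A)$, where $\lambda_n$ is Lebesgue measure, and the numbers of points in disjoint Borel sets are independent. Let $\mathbf Q$ be a probability measure on $\mathcal K^n$, concentrated on the bodies whose circumscribed ball is centered at the origin, with $\int V_n(K+B^n)\,\mathbf Q(dK)<\infty$, where $V_n$ is the volume and $B^n$ the unit ball. Let $Z_1,Z_2,\dots$ be independent random convex bodies with distribution $\mathbf Q$,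 independent of $(\xi_i)_{i\ge1}$, and let $Z=\bigcup_{i\ge 1}(\xi_i+Z_i)$ be the corresponding stationary Boolean model with convex grains. Let $K_0\in\mathcal K^n$ and $\varphi\in\mathrm{Val}$. Then $Z\cap K_0$ is almost surely polyconvex, $\mathbb E|\varphi(Z\cap K_0)|<\infty$, and $$\mathbb E\,\varphi(Z\cap K_0)=\sum_{k=1}^\infty\frac{(-1)^{k-1}}{k!}\gamma^k\int_{\mathcal K^n}\cdots\int_{\mathcal K^n}\Phi(K_0,K_1,\dots,K_k)\,\mathbf Q(dK_1)\cdots\mathbf Q(dK_k),$$ where $$\Phi(K_0,K_1,\dots,K_k)=\int_{(\mathbb R^n)^k}\varphi\bigl(K_0\cap(K_1+x_1)\cap\dots\cap(K_k+x_k)\bigr)\,\lambda_n^k(d(x_1,\dots,x_k)).$$ For every $k\ge1$ the integrand in the definition of $\Phi(K_0,K_1,\dots,K_k)$ is integrable for all $K_1,\dots,K_k\in\mathcal K^n$, the function $(K_1,\dots,K_k)\mapsto\Phi(K_0,K_1,\dots,K_k)$ is $\mathbf Q^{k}$-integrable, and the series converges absolutely. -/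

import Mathlib

open MeasureTheory ProbabilityTheory
open scoped Pointwise

/-- Euclidean space of dimension `n`; its `volume` is Lebesgue measure. -/
abbrev Eucl (n : ℕ) : Type := EuclideanSpace ℝ (Fin n)

/-- The space of (nonempty, compact) convex bodies carries the Borel σ-algebra of the Hausdorff
metric, which is the metric of `ConvexBody`. -/
noncomputable instance convexBodyMeasurableSpace (n : ℕ) : MeasurableSpace (ConvexBody (Eucl n)) := borel _

instance convexBodyBorelSpace (n : ℕ) : BorelSpace (ConvexBody (Eucl n)) := ⟨rfl⟩

/-- The class `Val` of translation invariant continuous real valuations on convex bodies.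
When `K`, `M` and `K ∪ M` are convex bodies, `K ∩ M` is automatically nonempty, hence a convex
body. -/
structure IsVal {n : ℕ} (φ : ConvexBody (Eucl n) → ℝ) : Prop where
  continuous : Continuous φ
  translation_invariant : ∀ (K L : ConvexBody (Eucl n)) (x : Eucl n),
    (L : Set (Eucl n)) = x +ᵥ (K : Set (Eucl n)) → φ L = φ K
  additive : ∀ K M U I : ConvexBody (Eucl n),
    (U : Set (Eucl n)) = (K : Set (Eucl n)) ∪ (M : Set (Eucl n)) →
    (I : Set (Eucl n)) = (K : Set (Eucl n)) ∩ (M : Set (Eucl n)) →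
    φ U + φ I = φ K + φ M

/-- Members of the convex ring: finite unions of convex bodies (the empty union is allowed). -/
def IsPolyconvex {n : ℕ} (A : Set (Eucl n)) : Prop :=
  ∃ (m : ℕ) (K : Fin m → ConvexBody (Eucl n)), A = ⋃ i, (K i : Set (Eucl n))

/-- `ψ` is the additive extension of `φ` to the convex ring, with the value `0` at the empty set.
Its values on the convex ring are determined by `φ` (inclusion-exclusion); the values on sets
outside of the convex ring are irrelevant. -/
structure IsAdditiveExtension {n : ℕ} (φ : ConvexBody (Eucl n) → ℝ)
    (ψ : Set (Eucl n) → ℝ) : Prop where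
  empty : ψ ∅ = 0
  eq_on_bodies : ∀ K : ConvexBody (Eucl n), ψ (K : Set (Eucl n)) = φ K
  additive : ∀ A B : Set (Eucl n), IsPolyconvex A → IsPolyconvex B →
    ψ (A ∪ B) + ψ (A ∩ B) = ψ A + ψ B

/-- The number `X(A)` of points of the process `X = {ξ 0, ξ 1, …}` in the set `A`. -/
noncomputable def pointCount {n : ℕ} {Ω : Type*} (ξ : ℕ → Ω → Eucl n) (A : Set (Eucl n))
    (ω : Ω) : ℕ∞ :=
  {i : ℕ | ξ i ω ∈ A}.encard

/-- `ξ 0, ξ 1, …` is a measurable enumeration of the (distinct) points of a stationary Poisson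
process with intensity `γ > 0`: the number of points in a bounded Borel set `A` is Poisson
distributed with parameter `γ λ(A)` (in particular almost surely finite), and the numbers of
points in disjoint Borel sets are independent. Since `γ λ` has infinite total mass, there are
almost surely infinitely many points. -/
structure IsStationaryPoissonProcess {n : ℕ} {Ω : Type*} [MeasurableSpace Ω] (P : Measure Ω)
    (γ : ℝ) (ξ : ℕ → Ω → Eucl n) : Prop where
  intensity_pos : 0 < γ
  measurable : ∀ i, Measurable (ξ i)
  simple : ∀ᵐ ω ∂P, Function.Injective (fun i => ξ i ω)
  count_law : ∀ A : Set (Eucl n), MeasurableSet A → Bornology.IsBounded A → ∀ k : ℕ,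
    P {ω | pointCount ξ A ω = k} =
      ENNReal.ofReal (Real.exp (-(γ * volume.real A)) * (γ * volume.real A) ^ k / k.factorial)
  count_indep : ∀ (m : ℕ) (A : Fin m → Set (Eucl n)), (∀ j, MeasurableSet (A j)) →
    (∀ i j, i ≠ j → Disjoint (A i) (A j)) → iIndepFun (fun j => pointCount ξ (A j)) P

/-- `K` is centered: the center of its circumscribed ball (the unique ball of minimal radius
containing `K`) is the origin. -/
def IsCenteredBody {n : ℕ} (K : ConvexBody (Eucl n)) : Prop :=
  ∀ (c : Eucl n) (r : ℝ), (K : Set (Eucl n)) ⊆ Metric.closedBall c r →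
    (K : Set (Eucl n)) ⊆ Metric.closedBall 0 r

/-- The admissible grain distributions: probability measures on the space of convex bodies that
are concentrated on the centered bodies and satisfy `∫ V_n (K + B^n) Q(dK) < ∞`. -/
structure IsGrainDistribution {n : ℕ} (Q : Measure (ConvexBody (Eucl n))) : Prop where
  isProbabilityMeasure : IsProbabilityMeasure Q
  centered : ∀ᵐ K ∂Q, IsCenteredBody K
  volume_finite :
    ∫⁻ K, volume ((K : Set (Eucl n)) + Metric.closedBall (0 : Eucl n) 1) ∂Q < ⊤

/-- The data of a stationary Boolean model with convex grains: a stationary Poisson process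
of germs `ξ i` with intensity `γ`, and independent grains `G i` with distribution `Q` that are
independent of the germs. -/
structure IsStationaryBooleanModel {n : ℕ} {Ω : Type*} [MeasurableSpace Ω] (P : Measure Ω)
    (γ : ℝ) (Q : Measure (ConvexBody (Eucl n))) (ξ : ℕ → Ω → Eucl n)
    (G : ℕ → Ω → ConvexBody (Eucl n)) : Prop where
  germs : IsStationaryPoissonProcess P γ ξ
  grainDistribution : IsGrainDistribution Q
  grain_measurable : ∀ i, Measurable (G i)
  grain_law : ∀ i, P.map (G i) = Q
  grain_indep : iIndepFun G P
  germs_grains_indep : IndepFun (fun ω i => ξ i ω) (fun ω i => G i ω) P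

/-- The random set `Z = ⋃ i, (ξ i + G i)`. -/
def booleanModelSet {n : ℕ} {Ω : Type*} (ξ : ℕ → Ω → Eucl n)
    (G : ℕ → Ω → ConvexBody (Eucl n)) (ω : Ω) : Set (Eucl n) :=
  ⋃ i, (ξ i ω +ᵥ (G i ω : Set (Eucl n)))

/-- `K₀ ∩ (K 0 + x 0) ∩ … ∩ (K (k-1) + x (k-1))`. -/
def translateInter {n k : ℕ} (K₀ : ConvexBody (Eucl n)) (K : Fin k → ConvexBody (Eucl n))
    (x : Fin k → Eucl n) : Set (Eucl n) :=
  (K₀ : Set (Eucl n)) ∩ ⋂ i, (x i +ᵥ (K i : Set (Eucl n)))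

/-- The iterated translative integral `Φ(K₀, K 0, …, K (k-1))`. -/
noncomputable def translativeIntegral {n k : ℕ} (ψ : Set (Eucl n) → ℝ)
    (K₀ : ConvexBody (Eucl n)) (K : Fin k → ConvexBody (Eucl n)) : ℝ :=
  ∫ x : Fin k → Eucl n, ψ (translateInter K₀ K x)

/-! The expansion is inclusion-exclusion, integrated term by term.

Almost surely only finitely many grains hit `K₀`, so `Z ∩ K₀` is a finite union of bodies. Its value
is an alternating sum over finite index sets (`hasSum_iUnion_inter`). Counting each set of size `k`
through its `k!` enumerations turns this into a sum over injective `k`-tuples of indices with weight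
`(-1)^(k-1) / k!`. The laws of (germs, grains) along all injective `k`-tuples add up to `γ^k λ^k ⊗
Q^k` (`IsStationaryBooleanModel.sum_map_tuple`), so integration produces the integrals of `Φ`.

To exchange sum and expectation, Blaschke selection bounds `φ` by a constant `C` on the bodies
inside `K₀`. The terms of order `k` then have total absolute expectation at most `C a^k / k!`, where
`a` is the mean number of grains hitting `K₀`. It is finite because `K₀` is covered by finitely many
unit balls. `HasSum` over the reals is unconditional, hence gives absolute convergence.

Two ingredients are built from scratch. Groemer's theorem (`sum_zeroExtend_eq_zero`) makes `φ` a
linear functional of indicators, which yields the additive extension and inclusion-exclusion. The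
factorial moment measures of the Poisson process are obtained from counts in disjoint boxes, since
such boxes cover all injective tuples and the remaining tuples are null. -/

section BooleanModel

open Set Filter Topology TopologicalSpace
open scoped ENNReal NNReal

/-! ### The hit-and-miss topology on convex bodies and Blaschke selection. -/

namespace ConvexBody

section Vietoris

variable {V : Type*} [NormedAddCommGroup V] [NormedSpace ℝ V]

/-- A convex body as a nonempty compact set. -/
def toNonemptyCompacts (K : ConvexBody V) : NonemptyCompacts V :=
  ⟨⟨K, K.isCompact⟩, K.nonempty⟩

@[simp]
theorem coe_toNonemptyCompacts (K : ConvexBody V) : (K.toNonemptyCompacts : Set V) = K := rfl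

theorem isometry_toNonemptyCompacts :
    Isometry (toNonemptyCompacts : ConvexBody V → NonemptyCompacts V) := by
  refine Isometry.of_dist_eq fun K L => ?_
  rw [Metric.NonemptyCompacts.dist_eq, coe_toNonemptyCompacts, coe_toNonemptyCompacts,
    hausdorffDist_coe]

/-- The sub-basis of hit and miss sets of the topology of the Hausdorff metric. -/
theorem topology_eq_generateFrom :
    @UniformSpace.toTopologicalSpace (ConvexBody V) _ = generateFrom
      ((fun U => {K : ConvexBody V | (K : Set V) ⊆ U}) '' {U | IsOpen U} ∪
        (fun U => {K : ConvexBody V | ((K : Set V) ∩ U).Nonempty}) '' {U | IsOpen U}) := by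
  rw [isometry_toNonemptyCompacts.isEmbedding.eq_induced]
  -- The topology on `NonemptyCompacts` is by definition the one induced from the Vietoris topology
  -- on sets.
  change TopologicalSpace.induced _ (TopologicalSpace.induced _ (generateFrom _)) = _
  rw [induced_compose]
  rw [induced_generateFrom_eq, image_union, image_image, image_image]
  rfl

instance [SecondCountableTopology V] : SecondCountableTopology (ConvexBody V) :=
  isometry_toNonemptyCompacts.isEmbedding.secondCountableTopology

theorem isClosed_setOf_mem : IsClosed {p : V × ConvexBody V | p.1 ∈ p.2} := by
  have h : {p : V × ConvexBody V | p.1 ∈ p.2} =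
      (fun p : V × ConvexBody V => Metric.infDist p.1 (p.2.toNonemptyCompacts : Set V)) ⁻¹' {0} := by
    ext ⟨x, K⟩
    simp only [mem_ofPred_eq, mem_preimage, mem_singleton_iff, coe_toNonemptyCompacts]
    rw [← K.isClosed.mem_iff_infDist_zero K.nonempty]
    rfl
  rw [h]
  exact isClosed_singleton.preimage (Metric.lipschitz_infDist.continuous.comp
    (continuous_fst.prodMk (isometry_toNonemptyCompacts.continuous.comp continuous_snd)))

/-- By compactness a decreasing sequence eventually enters every open set around its intersection,
and whatever hits `L` hits each larger `K j`. These are the two kinds of sub-basic sets. -/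
theorem tendsto_of_antitone_iInter {K : ℕ → ConvexBody V} {L : ConvexBody V}
    (hK : Antitone fun j => (K j : Set V)) (hL : (L : Set V) = ⋂ j, (K j : Set V)) :
    Tendsto K atTop (𝓝 L) := by
  rw [topology_eq_generateFrom, tendsto_nhds_generateFrom_iff]
  rintro s (⟨U, hU, rfl⟩ | ⟨U, hU, rfl⟩) hs
  · obtain ⟨j, hj⟩ := exists_subset_nhds_of_isCompact (V := fun j => (K j : Set V))
      hK.directed_ge (fun j => (K j).isCompact) (U := U)
      (fun x hx => (show IsOpen U from hU).mem_nhds (hs (hL ▸ hx)))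
    exact mem_atTop_sets.2 ⟨j, fun i hi => (hK hi).trans hj⟩
  · refine univ_mem' fun j => ?_
    exact Set.Nonempty.mono (inter_subset_inter_left _ (hL ▸ iInter_subset _ j)) hs

/-- Convexity says `aC + bC ⊆ C` for all convex weights. Written as `(aC + bC) ⊔ C = C`, it is an
equality of continuous functions of `C`. -/
theorem isClosed_range_toNonemptyCompacts :
    IsClosed (range (toNonemptyCompacts : ConvexBody V → NonemptyCompacts V)) := by
  have h : range (toNonemptyCompacts : ConvexBody V → NonemptyCompacts V) =
      ⋂ (a : ℝ) (b : ℝ) (_ : 0 ≤ a) (_ : 0 ≤ b) (_ : a + b = 1), {C : NonemptyCompacts V |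
        (C ×ˢ C).map (fun p : V × V => a • p.1 + b • p.2) (by fun_prop) ⊔ C = C} := by
    ext C
    have hC : C ∈ range (toNonemptyCompacts : ConvexBody V → NonemptyCompacts V) ↔
        Convex ℝ (C : Set V) := by
      refine ⟨?_, fun h => ⟨⟨C, h, C.isCompact, C.nonempty⟩, rfl⟩⟩
      rintro ⟨K, rfl⟩
      exact K.convex
    rw [hC]
    simp only [mem_iInter, mem_ofPred_eq, sup_eq_right]
    constructor
    · rintro h a b ha hb hab _ ⟨⟨x, y⟩, ⟨hx, hy⟩, rfl⟩
      exact h hx hy ha hb hab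
    · intro h x hx y hy a b ha hb hab
      exact h a b ha hb hab ⟨(x, y), ⟨hx, hy⟩, rfl⟩
  rw [h]
  refine isClosed_iInter fun a => isClosed_iInter fun b => isClosed_iInter fun _ =>
    isClosed_iInter fun _ => isClosed_iInter fun _ => isClosed_eq ?_ continuous_id
  have hc : Continuous fun p : V × V => a • p.1 + b • p.2 := by fun_prop
  exact ((hc.nonemptyCompacts_map).comp
    (NonemptyCompacts.continuous_prod.comp (continuous_id.prodMk continuous_id))).sup continuous_id

/-- A form of the Blaschke selection theorem. -/
theorem isCompact_setOf_subset {s : Set V} (hs : IsCompact s) :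
    IsCompact {K : ConvexBody V | (K : Set V) ⊆ s} := by
  have h : IsClosedEmbedding fun K : ConvexBody V => K.toNonemptyCompacts.toCompacts :=
    NonemptyCompacts.isClosedEmbedding_toCompacts.comp
      ⟨isometry_toNonemptyCompacts.isEmbedding, isClosed_range_toNonemptyCompacts⟩
  exact h.isCompact_preimage (Compacts.isCompact_subsets_of_isCompact hs)

theorem exists_bound_of_continuous {φ : ConvexBody V → ℝ} (hφ : Continuous φ) {s : Set V}
    (hs : IsCompact s) : ∃ C : ℝ, 0 ≤ C ∧ ∀ K : ConvexBody V, (K : Set V) ⊆ s → ‖φ K‖ ≤ C := by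
  obtain ⟨C, hC⟩ := (isCompact_setOf_subset hs).exists_bound_of_continuousOn hφ.continuousOn
  exact ⟨max C 0, le_max_right _ _, fun K hK => (hC K hK).trans (le_max_left _ _)⟩

/-- Measurability of maps into the space of convex bodies can be tested on closed hitting sets. -/
theorem measurable_of_hit_closed [SecondCountableTopology V] [MeasurableSpace (ConvexBody V)]
    [BorelSpace (ConvexBody V)] {α : Type*} [MeasurableSpace α] {f : α → ConvexBody V}
    (hf : ∀ F : Set V, IsClosed F → MeasurableSet {a | ((f a : Set V) ∩ F).Nonempty}) :
    Measurable f := by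
  rw [BorelSpace.measurable_eq (α := ConvexBody V),
    borel_eq_generateFrom_of_subbasis (topology_eq_generateFrom (V := V))]
  refine measurable_generateFrom ?_
  rintro s (⟨U, hU, rfl⟩ | ⟨U, hU, rfl⟩)
  · have : f ⁻¹' {K : ConvexBody V | (K : Set V) ⊆ U} =
        {a | ((f a : Set V) ∩ Uᶜ).Nonempty}ᶜ := by
      ext a
      simp [inter_compl_nonempty_iff]
    rw [this]
    exact (hf _ (IsOpen.isClosed_compl hU)).compl
  · obtain ⟨F, hF, -, hFU, -⟩ := IsOpen.exists_iUnion_isClosed (show IsOpen U from hU)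
    have : f ⁻¹' {K : ConvexBody V | ((K : Set V) ∩ U).Nonempty} =
        ⋃ j, {a | ((f a : Set V) ∩ F j).Nonempty} := by
      ext a
      simp only [mem_preimage, mem_ofPred_eq, mem_iUnion, ← nonempty_iUnion, ← inter_iUnion, hFU]
    rw [this]
    exact MeasurableSet.iUnion fun j => hf _ (hF j)

end Vietoris

end ConvexBody

/-! ### Groemer's theorem and the additive extension. -/

section

variable {n : ℕ}

/-- The empty set and the convex bodies. -/
def IsConvexCompact (s : Set (Eucl n)) : Prop := Convex ℝ s ∧ IsCompact s

namespace IsConvexCompact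

theorem empty : IsConvexCompact (∅ : Set (Eucl n)) := ⟨convex_empty, isCompact_empty⟩

theorem inter {s t : Set (Eucl n)} (hs : IsConvexCompact s) (ht : IsConvexCompact t) :
    IsConvexCompact (s ∩ t) := ⟨hs.1.inter ht.1, hs.2.inter ht.2⟩

theorem inter_isClosed {s t : Set (Eucl n)} (hs : IsConvexCompact s) (ht : Convex ℝ t)
    (htc : IsClosed t) : IsConvexCompact (s ∩ t) := ⟨hs.1.inter ht, hs.2.inter_right htc⟩

theorem exists_body {s : Set (Eucl n)} (hs : IsConvexCompact s) (hne : s.Nonempty) :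
    ∃ K : ConvexBody (Eucl n), (K : Set (Eucl n)) = s := ⟨⟨s, hs.1, hs.2, hne⟩, rfl⟩

theorem biInter {ι : Type*} {t : Finset ι} (ht : t.Nonempty) {C : ι → Set (Eucl n)}
    (hC : ∀ i, IsConvexCompact (C i)) : IsConvexCompact (⋂ i ∈ t, C i) := by
  obtain ⟨i, hi⟩ := ht
  exact ⟨convex_iInter₂ fun i _ => (hC i).1, (hC i).2.of_isClosed_subset
    (isClosed_biInter fun i _ => (hC i).2.isClosed) (biInter_subset_of_mem hi)⟩

end IsConvexCompact

theorem ConvexBody.isConvexCompact (K : ConvexBody (Eucl n)) :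
    IsConvexCompact (K : Set (Eucl n)) := ⟨K.convex, K.isCompact⟩

open Classical in
/-- The extension of a function on convex bodies by zero. -/
noncomputable def zeroExtend (φ : ConvexBody (Eucl n) → ℝ) (s : Set (Eucl n)) : ℝ :=
  if h : ∃ K : ConvexBody (Eucl n), (K : Set (Eucl n)) = s then φ h.choose else 0

@[simp]
theorem zeroExtend_coe (φ : ConvexBody (Eucl n) → ℝ) (K : ConvexBody (Eucl n)) :
    zeroExtend φ (K : Set (Eucl n)) = φ K := by
  have h : ∃ L : ConvexBody (Eucl n), (L : Set (Eucl n)) = K := ⟨K, rfl⟩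
  rw [zeroExtend, dif_pos h]
  exact congrArg φ (SetLike.coe_injective h.choose_spec)

@[simp]
theorem zeroExtend_empty (φ : ConvexBody (Eucl n) → ℝ) : zeroExtend φ ∅ = 0 := by
  rw [zeroExtend, dif_neg]
  rintro ⟨K, hK⟩
  exact K.nonempty.ne_empty hK

namespace IsVal

variable {φ : ConvexBody (Eucl n) → ℝ}

/-- If both halves are nonempty, connectedness makes the hyperplane section nonempty and the
valuation property applies. Otherwise one half is all of `s`, and the other terms are values at the
empty set. -/
theorem zeroExtend_halfSpace (hφ : IsVal φ) {s : Set (Eucl n)} (hs : IsConvexCompact s)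
    (l : StrongDual ℝ (Eucl n)) (c : ℝ) :
    zeroExtend φ s = zeroExtend φ (s ∩ {x | l x ≤ c}) + zeroExtend φ (s ∩ {x | c ≤ l x}) -
      zeroExtend φ (s ∩ {x | l x = c}) := by
  have hcov : s = (s ∩ {x | l x ≤ c}) ∪ (s ∩ {x | c ≤ l x}) := by
    ext x
    have := le_total (l x) c
    simp only [mem_union, mem_inter_iff, mem_ofPred_eq]
    tauto
  have hint : s ∩ {x | l x = c} = (s ∩ {x | l x ≤ c}) ∩ (s ∩ {x | c ≤ l x}) := by
    ext x
    simp only [mem_inter_iff, mem_ofPred_eq, le_antisymm_iff]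
    tauto
  rcases (s ∩ {x | l x ≤ c}).eq_empty_or_nonempty with h1 | h1
  · rw [hint, h1, empty_inter, zeroExtend_empty, zero_add, sub_zero]
    rw [h1, empty_union] at hcov
    rw [← hcov]
  rcases (s ∩ {x | c ≤ l x}).eq_empty_or_nonempty with h2 | h2
  · rw [hint, h2, inter_empty, zeroExtend_empty, add_zero, sub_zero]
    rw [h2, union_empty] at hcov
    rw [← hcov]
  have h3 : (s ∩ {x | l x = c}).Nonempty := by
    obtain ⟨x, hx, hxc⟩ := h1
    obtain ⟨y, hy, hyc⟩ := h2
    obtain ⟨z, hz, hzc⟩ := hs.1.isPreconnected.intermediate_value hx hy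
      l.continuous.continuousOn ⟨hxc, hyc⟩
    exact ⟨z, hz, hzc⟩
  obtain ⟨U, hU⟩ := hs.exists_body (h1.mono inter_subset_left)
  obtain ⟨K, hK⟩ := (hs.inter_isClosed (convex_halfSpace_le l.toLinearMap.isLinear c)
    (isClosed_le l.continuous continuous_const)).exists_body h1
  obtain ⟨M, hM⟩ := (hs.inter_isClosed (convex_halfSpace_ge l.toLinearMap.isLinear c)
    (isClosed_le continuous_const l.continuous)).exists_body h2
  obtain ⟨I, hI⟩ := (hs.inter_isClosed (convex_hyperplane l.toLinearMap.isLinear c)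
    (isClosed_eq l.continuous continuous_const)).exists_body h3
  have := hφ.additive K M U I (by rw [hU, hK, hM]; exact hcov) (by rw [hI, hK, hM]; exact hint)
  have e : ∀ (A : ConvexBody (Eucl n)) (t : Set (Eucl n)), (A : Set (Eucl n)) = t →
      zeroExtend φ t = φ A := fun A t h => by rw [← h, zeroExtend_coe]
  rw [e U s hU, e K (s ∩ {x | l x ≤ c}) hK, e M (s ∩ {x | c ≤ l x}) hM,
    e I (s ∩ {x | l x = c}) hI]
  linarith

/-- The value zero at `∅` is compatible with continuity along decreasing sequences: if the
intersection is empty, some `s j` is already empty. -/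
theorem tendsto_zeroExtend (hφ : IsVal φ) {s : ℕ → Set (Eucl n)}
    (hs : ∀ j, IsConvexCompact (s j)) (hanti : Antitone s) :
    Tendsto (fun j => zeroExtend φ (s j)) atTop (𝓝 (zeroExtend φ (⋂ j, s j))) := by
  have hcl : IsConvexCompact (⋂ j, s j) := ⟨convex_iInter fun j => (hs j).1,
    (hs 0).2.of_isClosed_subset (isClosed_iInter fun j => (hs j).2.isClosed) (iInter_subset _ 0)⟩
  rcases (⋂ j, s j).eq_empty_or_nonempty with h | h
  · obtain ⟨j, hj⟩ := exists_subset_nhds_of_isCompact (V := s) hanti.directed_ge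
      (fun j => (hs j).2) (U := ∅) (fun x hx => by simp [h] at hx)
    rw [h, zeroExtend_empty]
    refine tendsto_const_nhds.congr' ?_
    filter_upwards [eventually_ge_atTop j] with i hi
    rw [subset_empty_iff.1 ((hanti hi).trans hj), zeroExtend_empty]
  · obtain ⟨L, hL⟩ := hcl.exists_body h
    choose K hK using fun j => (hs j).exists_body (h.mono (iInter_subset _ j))
    have := (hφ.continuous.tendsto L).comp (ConvexBody.tendsto_of_antitone_iInter (K := K) (L := L)
      (by simpa only [hK] using hanti) (by simp only [hK, hL]))
    rw [← hL, zeroExtend_coe]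
    exact this.congr fun j => by rw [← hK, zeroExtend_coe, Function.comp_apply]

section Groemer

variable {ι : Type*} [Fintype ι] {α : ι → ℝ} {s : ι → Set (Eucl n)}

theorem sum_indicator_inter_eq_zero (h : ∀ x, ∑ i, (s i).indicator (fun _ => α i) x = 0)
    (t : Set (Eucl n)) (x : Eucl n) : ∑ i, (s i ∩ t).indicator (fun _ => α i) x = 0 := by
  by_cases hx : x ∈ t
  · rw [← h x]
    refine Finset.sum_congr rfl fun i _ => ?_
    by_cases hi : x ∈ s i
    · rw [indicator_of_mem (show x ∈ s i ∩ t from ⟨hi, hx⟩), indicator_of_mem hi]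
    · rw [indicator_of_notMem fun h' => hi h'.1, indicator_of_notMem hi]
  · exact Finset.sum_eq_zero fun i _ => indicator_of_notMem (fun hx' => hx hx'.2) _

theorem tendsto_sum_zeroExtend_inter (hφ : IsVal φ) (hs : ∀ i, IsConvexCompact (s i))
    {D : ℕ → Set (Eucl n)} (hD : ∀ j, Convex ℝ (D j)) (hDc : ∀ j, IsClosed (D j))
    (hanti : Antitone D) :
    Tendsto (fun j => ∑ i, α i * zeroExtend φ (s i ∩ D j)) atTop
      (𝓝 (∑ i, α i * zeroExtend φ (s i ∩ ⋂ j, D j))) := by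
  refine tendsto_finsetSum _ fun i _ => Tendsto.const_mul _ ?_
  rw [inter_iInter]
  exact hφ.tendsto_zeroExtend (fun j => (hs i).inter_isClosed (hD j) (hDc j))
    fun j k hjk => inter_subset_inter_right _ (hanti hjk)

-- Induction on the number of nonempty sets. Intersecting the family with a set that misses one of
-- them lowers this number. Cutting with half-spaces therefore allows every set to be replaced by
-- its intersection with a chosen member, and finally with all of the nonempty members.
open Classical in
theorem sum_zeroExtend_eq_zero_of_card_le (hφ : IsVal φ) (N : ℕ) :
    ∀ s : ι → Set (Eucl n), (∀ i, IsConvexCompact (s i)) →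
      (∀ x, ∑ i, (s i).indicator (fun _ => α i) x = 0) →
      (Finset.univ.filter fun i => (s i).Nonempty).card ≤ N →
      ∑ i, α i * zeroExtend φ (s i) = 0 := by
  induction N with
  | zero =>
    intro s _ _ hcard
    rw [Nat.le_zero, Finset.card_eq_zero, Finset.filter_eq_empty_iff] at hcard
    refine Finset.sum_eq_zero fun i hi => ?_
    rw [not_nonempty_iff_eq_empty.1 (hcard hi), zeroExtend_empty, mul_zero]
  | succ N ih =>
    have card_mono : ∀ (s : ι → Set (Eucl n)) (t : Set (Eucl n)),
        (Finset.univ.filter fun i => (s i).Nonempty).card ≤ N + 1 →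
        (Finset.univ.filter fun i => (s i ∩ t).Nonempty).card ≤ N + 1 := fun s t h =>
      (Finset.card_le_card (Finset.monotone_filter_right _
        fun i _ (hi : (s i ∩ t).Nonempty) => hi.mono inter_subset_left)).trans h
    have miss : ∀ s : ι → Set (Eucl n), (∀ i, IsConvexCompact (s i)) →
        (∀ x, ∑ i, (s i).indicator (fun _ => α i) x = 0) →
        (Finset.univ.filter fun i => (s i).Nonempty).card ≤ N + 1 →
        ∀ i₀, (s i₀).Nonempty → ∀ t : Set (Eucl n), Convex ℝ t → IsClosed t → s i₀ ∩ t = ∅ →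
        ∑ i, α i * zeroExtend φ (s i ∩ t) = 0 := by
      intro s hs h hcard i₀ hne t ht htc hst
      refine ih _ (fun i => (hs i).inter_isClosed ht htc) (sum_indicator_inter_eq_zero h t) ?_
      refine Nat.lt_succ_iff.1 (lt_of_lt_of_le (Finset.card_lt_card ?_) hcard)
      refine Finset.ssubset_iff_of_subset (Finset.monotone_filter_right _
        fun i _ (hi : (s i ∩ t).Nonempty) => hi.mono inter_subset_left) |>.2 ⟨i₀, ?_, ?_⟩
      · simpa using hne
      · simp [hst]
    -- The far half-space and the hyperplane both miss `s i₀`, so their contributions vanish by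
    -- `miss`.
    have cut : ∀ s : ι → Set (Eucl n), (∀ i, IsConvexCompact (s i)) →
        (∀ x, ∑ i, (s i).indicator (fun _ => α i) x = 0) →
        (Finset.univ.filter fun i => (s i).Nonempty).card ≤ N + 1 →
        ∀ i₀, (s i₀).Nonempty → ∀ (l : StrongDual ℝ (Eucl n)) (c : ℝ), s i₀ ⊆ {x | l x < c} →
        ∑ i, α i * zeroExtend φ (s i) = ∑ i, α i * zeroExtend φ (s i ∩ {x | l x ≤ c}) := by
      intro s hs h hcard i₀ hne l c hlt
      have h1 := miss s hs h hcard i₀ hne {x | c ≤ l x}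
        (convex_halfSpace_ge l.toLinearMap.isLinear c) (isClosed_le continuous_const l.continuous)
        (eq_empty_of_forall_notMem fun x hx => (not_le.2 (show l x < c from hlt hx.1)) hx.2)
      have h2 := miss s hs h hcard i₀ hne {x | l x = c}
        (convex_hyperplane l.toLinearMap.isLinear c) (isClosed_eq l.continuous continuous_const)
        (eq_empty_of_forall_notMem fun x hx => absurd hx.2 (hlt hx.1).ne)
      simp only [hφ.zeroExtend_halfSpace (hs _) l c, mul_sub, mul_add, Finset.sum_sub_distrib,
        Finset.sum_add_distrib, h1, h2, add_zero, sub_zero]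
    -- When the hyperplane may touch `s i₀`, it is shifted outwards by `1/(j+1)` and `j` tends to
    -- infinity.
    have cut_le : ∀ s : ι → Set (Eucl n), (∀ i, IsConvexCompact (s i)) →
        (∀ x, ∑ i, (s i).indicator (fun _ => α i) x = 0) →
        (Finset.univ.filter fun i => (s i).Nonempty).card ≤ N + 1 →
        ∀ i₀, (s i₀).Nonempty → ∀ (l : StrongDual ℝ (Eucl n)) (c : ℝ), s i₀ ⊆ {x | l x ≤ c} →
        ∑ i, α i * zeroExtend φ (s i) = ∑ i, α i * zeroExtend φ (s i ∩ {x | l x ≤ c}) := by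
      intro s hs h hcard i₀ hne l c hle
      have hlim := hφ.tendsto_sum_zeroExtend_inter (α := α) hs
        (D := fun j : ℕ => {x | l x ≤ c + 1 / ((j : ℝ) + 1)})
        (fun j => convex_halfSpace_le l.toLinearMap.isLinear _)
        (fun j => isClosed_le l.continuous continuous_const)
        (fun j k hjk x (hx : l x ≤ _) => hx.trans
          (add_le_add_right (Nat.one_div_le_one_div hjk) c))
      have hD : ⋂ j : ℕ, {x | l x ≤ c + 1 / ((j : ℝ) + 1)} = {x | l x ≤ c} := by
        ext x
        simp only [mem_iInter, mem_ofPred_eq]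
        refine ⟨fun hx => ?_, fun hx j => hx.trans (le_add_of_nonneg_right (by positivity))⟩
        have := (tendsto_one_div_add_atTop_nhds_zero_nat (𝕜 := ℝ)).const_add c
        rw [add_zero] at this
        exact ge_of_tendsto' this hx
      rw [hD] at hlim
      refine tendsto_nhds_unique (tendsto_const_nhds.congr fun j => ?_) hlim
      exact cut s hs h hcard i₀ hne l _ fun x hx =>
        lt_of_le_of_lt (hle hx) (lt_add_of_pos_right c (by positivity))
    -- A closed convex set is a countable intersection of half-spaces: cut by finitely many of them,
    -- then pass to the limit.
    have cut_body : ∀ s : ι → Set (Eucl n), (∀ i, IsConvexCompact (s i)) →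
        (∀ x, ∑ i, (s i).indicator (fun _ => α i) x = 0) →
        (Finset.univ.filter fun i => (s i).Nonempty).card ≤ N + 1 →
        ∀ i₀, (s i₀).Nonempty →
        ∑ i, α i * zeroExtend φ (s i) = ∑ i, α i * zeroExtend φ (s i ∩ s i₀) := by
      intro s hs h hcard i₀ hne
      obtain ⟨l, c, hlc⟩ :=
        RCLike.iInter_countable_halfSpaces_eq (𝕜 := ℝ) (hs i₀).1 (hs i₀).2.isClosed
      simp only [RCLike.re_to_real] at hlc
      have hle : ∀ k, s i₀ ⊆ {x | l k x ≤ c k} := fun k => hlc ▸ iInter_subset _ k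
      set D : ℕ → Set (Eucl n) := fun m => ⋂ k ∈ Finset.range m, {x | l k x ≤ c k} with hDdef
      have hD : ∀ m, Convex ℝ (D m) := fun m =>
        convex_iInter₂ fun k _ => convex_halfSpace_le (l k).toLinearMap.isLinear _
      have hDc : ∀ m, IsClosed (D m) := fun m =>
        isClosed_biInter fun k _ => isClosed_le (l k).continuous continuous_const
      have hsD : ∀ m, s i₀ ∩ D m = s i₀ := fun m =>
        inter_eq_left.2 (subset_iInter₂ fun k _ => hle k)
      have hstep : ∀ m, ∑ i, α i * zeroExtend φ (s i) =
          ∑ i, α i * zeroExtend φ (s i ∩ D m) := by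
        intro m
        induction m with
        | zero => simp [hDdef]
        | succ m ihm =>
          rw [ihm, cut_le (fun i => s i ∩ D m) (fun i => (hs i).inter_isClosed (hD m) (hDc m))
            (sum_indicator_inter_eq_zero h _) (card_mono s _ hcard) i₀ (by rwa [hsD]) (l m) (c m)
            (by rw [hsD]; exact hle m)]
          refine Finset.sum_congr rfl fun i _ => ?_
          rw [inter_assoc]
          congr 3
          simp only [hDdef]
          rw [Finset.range_add_one, Finset.set_biInter_insert, inter_comm]
      have hlim := hφ.tendsto_sum_zeroExtend_inter (α := α) hs hD hDc
        (fun j k hjk => biInter_subset_biInter_left fun i hi =>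
          Finset.mem_range.2 ((Finset.mem_range.1 hi).trans_le hjk))
      have hDi : ⋂ m, D m = s i₀ := by
        rw [← hlc]
        ext x
        simp only [hDdef, mem_iInter, Finset.mem_range]
        exact ⟨fun hx k => hx (k + 1) k (Nat.lt_succ_self k), fun hx _ k _ => hx k⟩
      rw [hDi] at hlim
      exact tendsto_nhds_unique (tendsto_const_nhds.congr hstep) hlim
    intro s hs h hcard
    have iter : ∀ T : Finset ι, (∀ i ∈ T, (s i).Nonempty) →
        ∑ i, α i * zeroExtend φ (s i) = ∑ i, α i * zeroExtend φ (s i ∩ ⋂ j ∈ T, s j) := by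
      intro T
      induction T using Finset.induction_on with
      | empty => intro; simp
      | insert i₀ T _ ihT =>
        intro hT
        have hcl : IsClosed (⋂ j ∈ T, s j) := isClosed_biInter fun j _ => (hs j).2.isClosed
        have hcv : Convex ℝ (⋂ j ∈ T, s j) := convex_iInter₂ fun j _ => (hs j).1
        rw [ihT fun i hi => hT i (Finset.mem_insert_of_mem hi), Finset.set_biInter_insert]
        rcases (s i₀ ∩ ⋂ j ∈ T, s j).eq_empty_or_nonempty with he | hne
        · rw [he, miss s hs h hcard i₀ (hT i₀ (Finset.mem_insert_self _ _)) _ hcv hcl he]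
          simp
        · rw [cut_body _ (fun i => (hs i).inter_isClosed hcv hcl) (sum_indicator_inter_eq_zero h _)
            (card_mono s _ hcard) i₀ hne]
          refine Finset.sum_congr rfl fun i _ => ?_
          congr 2
          ext x
          simp only [mem_inter_iff]
          tauto
    rw [iter (Finset.univ.filter fun i => (s i).Nonempty) (by simp)]
    -- Each nonempty `s i` contains `C`, so only multiples of the value at `C` remain. Evaluating
    -- the indicator relation at a point of `C` shows that their coefficients add up to zero.
    set C := ⋂ j ∈ Finset.univ.filter fun i => (s i).Nonempty, s j with hC
    have hval : ∀ i, α i * zeroExtend φ (s i ∩ C) =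
        (if (s i).Nonempty then α i else 0) * zeroExtend φ C := by
      intro i
      split_ifs with hi
      · have : C ⊆ s i := biInter_subset_of_mem (by simpa using hi)
        rw [inter_eq_right.2 this]
      · rw [not_nonempty_iff_eq_empty.1 hi]
        simp
    simp only [hval, ← Finset.sum_mul]
    rcases C.eq_empty_or_nonempty with he | ⟨x, hx⟩
    · rw [he, zeroExtend_empty, mul_zero]
    · have hx' : ∀ i, (s i).indicator (fun _ => α i) x = if (s i).Nonempty then α i else 0 := by
        intro i
        split_ifs with hi
        · exact indicator_of_mem (mem_iInter₂.1 hx i (by simpa using hi)) _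
        · rw [not_nonempty_iff_eq_empty.1 hi, indicator_empty]
      simp only [← hx', h x, zero_mul]

/-- **Groemer's theorem**: a linear relation between indicators is inherited by the values of a
continuous valuation. -/
theorem sum_zeroExtend_eq_zero (hφ : IsVal φ) (hs : ∀ i, IsConvexCompact (s i))
    (h : ∀ x, ∑ i, (s i).indicator (fun _ => α i) x = 0) :
    ∑ i, α i * zeroExtend φ (s i) = 0 := by
  classical
  exact hφ.sum_zeroExtend_eq_zero_of_card_le _ s hs h le_rfl

end Groemer

/-- The linear extension of a continuous valuation to functions. -/
theorem exists_linear_extension (hφ : IsVal φ) :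
    ∃ L : (Eucl n → ℝ) →ₗ[ℝ] ℝ, ∀ s : Set (Eucl n), IsConvexCompact s →
      L (s.indicator 1) = zeroExtend φ s := by
  set T : (ConvexBody (Eucl n) →₀ ℝ) →ₗ[ℝ] (Eucl n → ℝ) :=
    Finsupp.linearCombination ℝ fun K : ConvexBody (Eucl n) => (K : Set (Eucl n)).indicator 1
  set F : (ConvexBody (Eucl n) →₀ ℝ) →ₗ[ℝ] ℝ := Finsupp.linearCombination ℝ φ
  -- A functional factors through `T` as soon as it vanishes on the kernel of `T`, which is
  -- Groemer's theorem.
  have hF : F ∈ LinearMap.range T.dualMap := by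
    rw [LinearMap.range_dualMap_eq_dualAnnihilator_ker, Submodule.mem_dualAnnihilator]
    intro v hv
    have hv' : T v = 0 := hv
    have := sum_zeroExtend_eq_zero (ι := v.support) (α := fun K => v K)
      (s := fun K => (K : ConvexBody (Eucl n))) hφ (fun K => K.1.isConvexCompact) (fun x => by
        have hx := congrFun hv' x
        rw [Finsupp.linearCombination_apply, Finsupp.sum, Finset.sum_apply] at hx
        rw [Finset.univ_eq_attach, Finset.sum_attach v.support (fun K : ConvexBody (Eucl n) =>
          (K : Set (Eucl n)).indicator (fun _ => v K) x)]
        refine Eq.trans (Finset.sum_congr rfl fun K _ => ?_) hx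
        by_cases hxK : x ∈ (K : Set (Eucl n))
        · simp [indicator_of_mem hxK]
        · simp [indicator_of_notMem hxK])
    rw [Finset.univ_eq_attach] at this
    simp only [zeroExtend_coe] at this
    rw [Finset.sum_attach v.support (fun K : ConvexBody (Eucl n) => v K * φ K)] at this
    rw [Finsupp.linearCombination_apply, Finsupp.sum]
    simpa only [smul_eq_mul] using this
  obtain ⟨L, hL⟩ := hF
  refine ⟨L, fun s hs => ?_⟩
  rcases s.eq_empty_or_nonempty with rfl | hne
  · rw [indicator_empty, zeroExtend_empty]
    exact map_zero L
  · obtain ⟨K, rfl⟩ := hs.exists_body hne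
    have := LinearMap.congr_fun hL (Finsupp.single K 1)
    simpa [T, F] using this

theorem exists_isAdditiveExtension (hφ : IsVal φ) :
    ∃ ψ : Set (Eucl n) → ℝ, IsAdditiveExtension φ ψ := by
  obtain ⟨L, hL⟩ := hφ.exists_linear_extension
  refine ⟨fun s => L (s.indicator 1), ?_, fun K => ?_, fun A B _ _ => ?_⟩
  · rw [indicator_empty]
    exact map_zero L
  · rw [hL _ K.isConvexCompact, zeroExtend_coe]
  · rw [← map_add, ← map_add, indicator_union_add_inter]

end IsVal

/-! ### Inclusion-exclusion on the convex ring. -/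

namespace IsPolyconvex

theorem empty : IsPolyconvex (∅ : Set (Eucl n)) := ⟨0, Fin.elim0, by simp⟩

theorem of_isConvexCompact {s : Set (Eucl n)} (hs : IsConvexCompact s) : IsPolyconvex s := by
  rcases s.eq_empty_or_nonempty with rfl | hne
  · exact empty
  · obtain ⟨K, rfl⟩ := hs.exists_body hne
    exact ⟨1, fun _ => K, (iUnion_const _).symm⟩

theorem union {A B : Set (Eucl n)} (hA : IsPolyconvex A) (hB : IsPolyconvex B) :
    IsPolyconvex (A ∪ B) := by
  obtain ⟨k, K, rfl⟩ := hA
  obtain ⟨m, M, rfl⟩ := hB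
  refine ⟨k + m, fun i => Sum.elim K M (finSumFinEquiv.symm i), ?_⟩
  rw [finSumFinEquiv.symm.surjective.iUnion_comp
    (fun j => ((Sum.elim K M j : ConvexBody (Eucl n)) : Set (Eucl n))), iUnion_sum]
  rfl

theorem biUnion {ι : Type*} (s : Finset ι) {C : ι → Set (Eucl n)}
    (hC : ∀ i, IsConvexCompact (C i)) : IsPolyconvex (⋃ i ∈ s, C i) := by
  classical
  induction s using Finset.induction_on with
  | empty => simpa using empty
  | insert i s _ ih =>
    rw [Finset.set_biUnion_insert]
    exact (of_isConvexCompact (hC i)).union ih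

end IsPolyconvex

namespace IsAdditiveExtension

variable {φ : ConvexBody (Eucl n) → ℝ} {ψ : Set (Eucl n) → ℝ}

theorem eq_zeroExtend (hψ : IsAdditiveExtension φ ψ) {s : Set (Eucl n)}
    (hs : IsConvexCompact s) : ψ s = zeroExtend φ s := by
  rcases s.eq_empty_or_nonempty with rfl | hne
  · rw [hψ.empty, zeroExtend_empty]
  · obtain ⟨K, rfl⟩ := hs.exists_body hne
    rw [hψ.eq_on_bodies, zeroExtend_coe]

/-- Uniqueness of the additive extension. The induction generalizes over `C`, because splitting off
`C i` leaves the union of the sets `C i ∩ C j`, again with one index fewer. -/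
theorem biUnion_eq (hψ : IsAdditiveExtension φ ψ) {L : (Eucl n → ℝ) →ₗ[ℝ] ℝ}
    (hL : ∀ s : Set (Eucl n), IsConvexCompact s → L (s.indicator 1) = zeroExtend φ s)
    {ι : Type*} (s : Finset ι) {C : ι → Set (Eucl n)}
    (hC : ∀ i, IsConvexCompact (C i)) : ψ (⋃ i ∈ s, C i) = L ((⋃ i ∈ s, C i).indicator 1) := by
  classical
  induction s using Finset.induction_on generalizing C with
  | empty =>
    simp only [Finset.notMem_empty, iUnion_of_empty, iUnion_empty, hψ.empty, indicator_empty]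
    exact (map_zero L).symm
  | insert i s _ ih =>
    rw [Finset.set_biUnion_insert]
    have h1 := hψ.additive (C i) (⋃ j ∈ s, C j) (.of_isConvexCompact (hC i)) (.biUnion s hC)
    have h2 : L ((C i ∪ ⋃ j ∈ s, C j).indicator 1) + L ((C i ∩ ⋃ j ∈ s, C j).indicator 1) =
        L ((C i).indicator 1) + L ((⋃ j ∈ s, C j).indicator 1) := by
      rw [← map_add, ← map_add, indicator_union_add_inter]
    rw [hψ.eq_zeroExtend (hC i), ih hC] at h1
    rw [hL _ (hC i)] at h2
    have h3 := ih (C := fun j => C i ∩ C j) fun j => (hC i).inter (hC j)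
    rw [← inter_iUnion₂] at h3
    linarith

/-- The inclusion-exclusion formula. -/
theorem biUnion_eq_sum (hφ : IsVal φ) (hψ : IsAdditiveExtension φ ψ)
    {ι : Type*} (s : Finset ι) {C : ι → Set (Eucl n)} (hC : ∀ i, IsConvexCompact (C i)) :
    ψ (⋃ i ∈ s, C i) =
      ∑ t ∈ s.powerset with t.Nonempty, (-1) ^ (t.card + 1) * ψ (⋂ i ∈ t, C i) := by
  obtain ⟨L, hL⟩ := hφ.exists_linear_extension
  have h : (⋃ i ∈ s, C i).indicator (1 : Eucl n → ℝ) = ∑ t ∈ s.powerset with t.Nonempty,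
      (-1 : ℝ) ^ (t.card + 1) • (⋂ i ∈ t, C i).indicator (1 : Eucl n → ℝ) := by
    ext x
    rw [Finset.indicator_biUnion_eq_sum_powerset, Finset.sum_apply]
    refine Finset.sum_congr rfl fun t _ => ?_
    simp [zsmul_eq_mul]
  rw [hψ.biUnion_eq hL s hC, h, map_sum]
  refine Finset.sum_congr rfl fun t ht => ?_
  have hCt := IsConvexCompact.biInter (Finset.mem_filter.1 ht).2 hC
  rw [map_smul, hL _ hCt, hψ.eq_zeroExtend hCt, smul_eq_mul]

end IsAdditiveExtension

end

/-! ### Factorial moment measures of the Poisson process. -/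

instance countable_fin_embedding (k : ℕ) : Countable (Fin k ↪ ℕ) :=
  (DFunLike.coe_injective (F := Fin k ↪ ℕ)).countable

theorem ENNReal.prod_tsum_fin {ι : Type*} {k : ℕ} (f : Fin k → ι → ℝ≥0∞) :
    ∏ j, ∑' i, f j i = ∑' i : Fin k → ι, ∏ j, f j (i j) := by
  induction k with
  | zero => simp
  | succ k ih =>
    rw [Fin.prod_univ_succ, ih, ← (Fin.consEquiv fun _ => ι).tsum_eq,
      ← ENNReal.tsum_mul_right,
      ENNReal.tsum_prod (f := fun a b => ∏ j, f j ((Fin.consEquiv fun _ => ι) (a, b) j))]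
    refine tsum_congr fun a => ?_
    rw [← ENNReal.tsum_mul_left]
    refine tsum_congr fun b => ?_
    simp [Fin.consEquiv, Fin.prod_univ_succ]

theorem tsum_ofReal_poisson_mul (r : ℝ≥0) :
    ∑' k : ℕ, ENNReal.ofReal (Real.exp (-r) * r ^ k / k.factorial) * k = r := by
  rw [tsum_eq_zero_add' ENNReal.summable]
  have h : ∀ k : ℕ, ENNReal.ofReal (Real.exp (-r) * r ^ (k + 1) / (k + 1).factorial) *
      ((k + 1 : ℕ) : ℝ≥0∞) =
      r * ENNReal.ofReal (Real.exp (-r) * r ^ k / k.factorial) := by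
    intro k
    rw [← ENNReal.ofReal_natCast (k + 1), ← ENNReal.ofReal_mul (by positivity),
      ← ENNReal.ofReal_coe_nnreal, ← ENNReal.ofReal_mul (by positivity)]
    congr 1
    rw [Nat.factorial_succ]
    push_cast
    field_simp
    ring
  have hs := hasSum_one_poissonMeasure r
  simp only [h, ENNReal.tsum_mul_left]
  rw [← ENNReal.ofReal_tsum_of_nonneg (fun k => by positivity) hs.summable, hs.tsum_eq]
  simp

theorem tsum_ofReal_poisson (r : ℝ≥0) :
    ∑' k : ℕ, ENNReal.ofReal (Real.exp (-r) * r ^ k / k.factorial) = 1 := by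
  have hs := hasSum_one_poissonMeasure r
  rw [← ENNReal.ofReal_tsum_of_nonneg (fun k => by positivity) hs.summable, hs.tsum_eq]
  simp

/-- The diagonal is a linear subspace, and a proper one because the space contains a nonzero vector.
-/
theorem volume_setOf_apply_eq {n k : ℕ} (hn : n ≠ 0) {a b : Fin k} (hab : a ≠ b) :
    volume {x : Fin k → Eucl n | x a = x b} = 0 := by
  let S : Submodule ℝ (Fin k → Eucl n) :=
    LinearMap.ker (LinearMap.proj (R := ℝ) (φ := fun _ : Fin k => Eucl n) a - LinearMap.proj b)
  have hS : (S : Set (Fin k → Eucl n)) = {x : Fin k → Eucl n | x a = x b} := by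
    ext x
    simp [S, sub_eq_zero]
  rw [← hS]
  refine Measure.addHaar_submodule _ S fun htop => ?_
  obtain ⟨v, hv⟩ : ∃ v : Eucl n, v ≠ 0 := by
    have : NeZero n := ⟨hn⟩
    exact exists_ne 0
  have : Pi.single a v ∈ S := htop ▸ Submodule.mem_top
  rw [← SetLike.mem_coe, hS] at this
  simp [Pi.single_eq_of_ne hab.symm] at this
  exact hv this

theorem pointCount_eq_tsum {n : ℕ} {Ω : Type*} (ξ : ℕ → Ω → Eucl n) (A : Set (Eucl n)) (ω : Ω) :
    (pointCount ξ A ω : ℝ≥0∞) = ∑' i, A.indicator 1 (ξ i ω) := by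
  rw [pointCount, ← ENNReal.tsum_set_one, tsum_subtype {i | ξ i ω ∈ A} (fun _ => (1 : ℝ≥0∞))]
  rfl

namespace IsStationaryPoissonProcess

variable {n : ℕ} {Ω : Type*} [MeasurableSpace Ω] {P : Measure Ω} {γ : ℝ} {ξ : ℕ → Ω → Eucl n}

theorem measurable_coe_pointCount (hξ : IsStationaryPoissonProcess P γ ξ) {A : Set (Eucl n)}
    (hA : MeasurableSet A) : Measurable fun ω => (pointCount ξ A ω : ℝ≥0∞) := by
  simp only [pointCount_eq_tsum]
  exact Measurable.tsum fun i => (measurable_one.indicator hA).comp (hξ.measurable i)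

theorem measurableSet_pointCount_eq (hξ : IsStationaryPoissonProcess P γ ξ) {A : Set (Eucl n)}
    (hA : MeasurableSet A) (k : ℕ) : MeasurableSet {ω | pointCount ξ A ω = k} := by
  have : {ω | pointCount ξ A ω = k} = (fun ω => (pointCount ξ A ω : ℝ≥0∞)) ⁻¹' {(k : ℝ≥0∞)} := by
    ext ω
    simp [← ENat.toENNReal_coe]
  rw [this]
  exact hξ.measurable_coe_pointCount hA (measurableSet_singleton _)

theorem measurable_tuple (hξ : IsStationaryPoissonProcess P γ ξ) {k : ℕ} (i : Fin k → ℕ) :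
    Measurable fun ω j => ξ (i j) ω := measurable_pi_lambda _ fun j => hξ.measurable (i j)

variable [IsProbabilityMeasure P]

theorem lintegral_pointCount (hξ : IsStationaryPoissonProcess P γ ξ) {A : Set (Eucl n)}
    (hA : MeasurableSet A) (hAb : Bornology.IsBounded A) :
    ∫⁻ ω, (pointCount ξ A ω : ℝ≥0∞) ∂P = ENNReal.ofReal γ * volume A := by
  set r : ℝ≥0 := (γ * volume.real A).toNNReal
  have hr : (r : ℝ) = γ * volume.real A :=
    Real.coe_toNNReal _ (mul_nonneg hξ.intensity_pos.le measureReal_nonneg)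
  have hlaw : ∀ k : ℕ, P {ω | pointCount ξ A ω = k} =
      ENNReal.ofReal (Real.exp (-r) * r ^ k / k.factorial) := fun k => by
    rw [hξ.count_law A hA hAb k, hr]
  -- The Poisson weights already sum to one, leaving no mass for an infinite count.
  have hfin : ∀ᵐ ω ∂P, ∃ k : ℕ, pointCount ξ A ω = k := by
    have hm : MeasurableSet (⋃ k : ℕ, {ω | pointCount ξ A ω = k}) :=
      MeasurableSet.iUnion fun k => hξ.measurableSet_pointCount_eq hA k
    have h1 : P (⋃ k : ℕ, {ω | pointCount ξ A ω = k}) = 1 := by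
      rw [measure_iUnion _ fun k => hξ.measurableSet_pointCount_eq hA k]
      · simp only [hlaw, tsum_ofReal_poisson]
      · intro k l hkl
        refine Set.disjoint_left.2 fun ω (h1 : _ = _) (h2 : _ = _) => hkl ?_
        exact_mod_cast h1.symm.trans h2
    have := (prob_compl_eq_zero_iff hm).2 h1
    rw [ae_iff]
    convert this using 2
    ext ω
    simp
  have hpt : ∀ᵐ ω ∂P, (pointCount ξ A ω : ℝ≥0∞) =
      ∑' k : ℕ, {ω | pointCount ξ A ω = k}.indicator (fun _ => (k : ℝ≥0∞)) ω := by
    filter_upwards [hfin] with ω ⟨k, hk⟩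
    rw [tsum_eq_single k (fun l hl => ?_),
      indicator_of_mem (show ω ∈ {ω | pointCount ξ A ω = k} from hk), hk, ENat.toENNReal_coe]
    have hnot : ω ∉ {ω | pointCount ξ A ω = l} := fun (h : pointCount ξ A ω = l) =>
      hl (by exact_mod_cast h.symm.trans hk)
    exact indicator_of_notMem hnot _
  rw [lintegral_congr_ae hpt, lintegral_tsum fun k => (measurable_const.indicator
    (hξ.measurableSet_pointCount_eq hA k)).aemeasurable]
  simp only [lintegral_indicator_const (hξ.measurableSet_pointCount_eq hA _), hlaw]
  simp only [mul_comm _ (ENNReal.ofReal (_ / _)), tsum_ofReal_poisson_mul]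
  rw [← ENNReal.ofReal_coe_nnreal, hr, ENNReal.ofReal_mul hξ.intensity_pos.le, Measure.real,
    ENNReal.ofReal_toReal hAb.measure_lt_top.ne]

/-- The product of the counts expands into a sum over all index tuples. Disjointness of the boxes
kills the non-injective ones, and independence factorizes the expectation. -/
theorem tsum_measure_disjoint_box (hξ : IsStationaryPoissonProcess P γ ξ) {k : ℕ}
    {A : Fin k → Set (Eucl n)} (hA : ∀ j, MeasurableSet (A j))
    (hAb : ∀ j, Bornology.IsBounded (A j)) (hd : ∀ i j, i ≠ j → Disjoint (A i) (A j)) :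
    ∑' i : Fin k ↪ ℕ, P {ω | ∀ j, ξ (i j) ω ∈ A j} = ∏ j, (ENNReal.ofReal γ * volume (A j)) := by
  have hprod : ∀ ω, ∏ j, (pointCount ξ (A j) ω : ℝ≥0∞) =
      ∑' i : Fin k ↪ ℕ, {ω | ∀ j, ξ (i j) ω ∈ A j}.indicator (fun _ => (1 : ℝ≥0∞)) ω := by
    intro ω
    have hval : ∀ i : Fin k → ℕ, ∏ j, (A j).indicator (1 : Eucl n → ℝ≥0∞) (ξ (i j) ω) =
        {ω | ∀ j, ξ (i j) ω ∈ A j}.indicator (fun _ => (1 : ℝ≥0∞)) ω := by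
      intro i
      by_cases h : ∀ j, ξ (i j) ω ∈ A j
      · rw [indicator_of_mem (show ω ∈ {ω | ∀ j, ξ (i j) ω ∈ A j} from h)]
        exact Finset.prod_eq_one fun j _ => indicator_of_mem (h j) _
      · rw [indicator_of_notMem (show ω ∉ {ω | ∀ j, ξ (i j) ω ∈ A j} from h)]
        obtain ⟨j, hj⟩ := not_forall.1 h
        exact Finset.prod_eq_zero (Finset.mem_univ j) (indicator_of_notMem hj _)
    simp only [pointCount_eq_tsum]
    rw [ENNReal.prod_tsum_fin fun j i => (A j).indicator (1 : Eucl n → ℝ≥0∞) (ξ i ω)]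
    simp only [hval]
    refine (Function.Injective.tsum_eq (g := fun i : Fin k ↪ ℕ => (i : Fin k → ℕ))
      DFunLike.coe_injective (f := fun i : Fin k → ℕ =>
        {ω | ∀ j, ξ (i j) ω ∈ A j}.indicator (fun _ => (1 : ℝ≥0∞)) ω) fun i hi => ?_).symm
    have hi' : ∀ j, ξ (i j) ω ∈ A j := mem_of_indicator_ne_zero hi
    refine ⟨⟨i, fun a b hab => ?_⟩, rfl⟩
    by_contra hne
    exact Set.disjoint_left.1 (hd a b hne) (hi' a) (by rw [hab]; exact hi' b)
  have hmeas : ∀ i : Fin k ↪ ℕ, MeasurableSet {ω | ∀ j, ξ (i j) ω ∈ A j} := fun i => by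
    rw [ofPred_forall]
    exact MeasurableSet.iInter fun j => hξ.measurable _ (hA j)
  have hind := (hξ.count_indep k A hA hd).comp (fun _ (m : ℕ∞) => (m : ℝ≥0∞))
    fun _ => measurable_from_top
  have h := lintegral_prod_eq_prod_lintegral_of_indepFun Finset.univ _ hind
    fun j => hξ.measurable_coe_pointCount (hA j)
  simp only [Function.comp_apply, hξ.lintegral_pointCount (hA _) (hAb _), hprod] at h
  rw [← h, lintegral_tsum fun i => (measurable_const.indicator (hmeas i)).aemeasurable]
  simp only [lintegral_indicator_const (hmeas _), one_mul]

/-- The factorial moment measures of a stationary Poisson process. -/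
theorem sum_map_tuple (hξ : IsStationaryPoissonProcess P γ ξ) (hn : n ≠ 0) (k : ℕ) :
    Measure.sum (fun i : Fin k ↪ ℕ => P.map fun ω j => ξ (i j) ω) =
      ENNReal.ofReal γ ^ k • (volume : Measure (Fin k → Eucl n)) := by
  set M := Measure.sum fun i : Fin k ↪ ℕ => P.map fun ω j => ξ (i j) ω
  set ν := ENNReal.ofReal γ ^ k • (volume : Measure (Fin k → Eucl n))
  -- Inside a product of disjoint bounded sets, both measures have the values on boxes that
  -- characterize the same finite product measure.
  have hbox : ∀ C : Fin k → Set (Eucl n), (∀ j, MeasurableSet (C j)) →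
      (∀ j, Bornology.IsBounded (C j)) → (∀ i j, i ≠ j → Disjoint (C i) (C j)) →
      M.restrict (univ.pi C) = ν.restrict (univ.pi C) := by
    intro C hC hCb hd
    have : ∀ j, IsFiniteMeasure (volume.restrict (C j)) := fun j =>
      ⟨by simpa using (hCb j).measure_lt_top⟩
    have : ∀ j, IsFiniteMeasure (ENNReal.ofReal γ • (volume.restrict (C j))) := fun j =>
      Measure.smul_finite _ ENNReal.ofReal_ne_top
    have h1 : Measure.pi (fun j => ENNReal.ofReal γ • (volume.restrict (C j))) =
        M.restrict (univ.pi C) := by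
      refine Measure.pi_eq fun A hA => ?_
      have hm : MeasurableSet (univ.pi fun j => A j ∩ C j) :=
        MeasurableSet.univ_pi fun j => (hA j).inter (hC j)
      rw [Measure.restrict_apply (MeasurableSet.univ_pi hA), ← pi_inter_distrib,
        Measure.sum_apply _ hm]
      have := hξ.tsum_measure_disjoint_box (A := fun j => A j ∩ C j)
        (fun j => (hA j).inter (hC j)) (fun j => (hCb j).subset inter_subset_right)
        (fun i j hij => (hd i j hij).mono inter_subset_right inter_subset_right)
      simp only [Measure.smul_apply, smul_eq_mul, Measure.restrict_apply (hA _)]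
      rw [← this]
      refine tsum_congr fun i => ?_
      rw [Measure.map_apply (hξ.measurable_tuple i) hm]
      congr 1
      ext ω
      simp
    have h2 : Measure.pi (fun j => ENNReal.ofReal γ • (volume.restrict (C j))) =
        ν.restrict (univ.pi C) := by
      refine Measure.pi_eq fun A hA => ?_
      rw [Measure.restrict_apply (MeasurableSet.univ_pi hA), ← pi_inter_distrib]
      simp only [ν, Measure.smul_apply, smul_eq_mul, Measure.restrict_apply (hA _), volume_pi_pi,
        Finset.prod_mul_distrib, Finset.prod_const, Finset.card_univ, Fintype.card_fin]
    rw [← h1, h2]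
  let B := countableBasis (Eucl n)
  have : Countable B := (countable_countableBasis _).to_subtype
  -- Countably many products of disjoint bounded basis sets cover exactly the injective tuples, so
  -- local agreement gives agreement there.
  let I := {c : Fin k → B // (∀ j, Bornology.IsBounded (c j : Set (Eucl n))) ∧
    ∀ i j, i ≠ j → Disjoint (c i : Set (Eucl n)) (c j)}
  have hcov : (⋃ c : I, univ.pi fun j => (c.1 j : Set (Eucl n))) =
      {x : Fin k → Eucl n | Function.Injective x} := by
    ext x
    simp only [mem_iUnion, mem_ofPred_eq]
    constructor
    · rintro ⟨c, hc⟩ a b hab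
      by_contra hne
      exact Set.disjoint_left.1 (c.2.2 a b hne) (hc a (mem_univ a))
        (by rw [hab]; exact hc b (mem_univ b))
    · intro hx
      obtain ⟨U, hU, hUd⟩ := (finite_range x).t2_separation
      have hch : ∀ j, ∃ b ∈ B, x j ∈ b ∧ b ⊆ U (x j) ∩ Metric.ball (x j) 1 := fun j =>
        (isBasis_countableBasis (Eucl n)).exists_subset_of_mem_open
          ⟨(hU (x j)).1, Metric.mem_ball_self one_pos⟩ ((hU (x j)).2.inter Metric.isOpen_ball)
      choose b hbB hxb hbU using hch
      refine ⟨⟨fun j => ⟨b j, hbB j⟩, fun j => Metric.isBounded_ball.subset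
        ((hbU j).trans inter_subset_right), fun i j hij => ?_⟩, fun j _ => hxb j⟩
      exact (hUd (mem_range_self i) (mem_range_self j) (fun h => hij (hx h))).mono
        ((hbU i).trans inter_subset_left) ((hbU j).trans inter_subset_left)
  have hrestr : M.restrict {x | Function.Injective x} = ν.restrict {x | Function.Injective x} := by
    rw [← hcov, Measure.restrict_iUnion_congr]
    exact fun c => hbox _ (fun j => ((isBasis_countableBasis _).isOpen (c.1 j).2).measurableSet)
      c.2.1 c.2.2
  have hMae : ∀ᵐ x ∂M, x ∈ {x : Fin k → Eucl n | Function.Injective x} := by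
    have hmeas : MeasurableSet {x : Fin k → Eucl n | Function.Injective x} := by
      rw [← hcov]
      exact MeasurableSet.iUnion fun c => MeasurableSet.univ_pi
        fun j => ((isBasis_countableBasis _).isOpen (c.1 j).2).measurableSet
    refine (Measure.ae_sum_iff' hmeas).2 fun i => ?_
    rw [ae_map_iff (hξ.measurable_tuple i).aemeasurable hmeas]
    filter_upwards [hξ.simple] with ω hω
    exact hω.comp i.injective
  -- Non-injective tuples lie in finitely many null diagonals.
  have hνae : ∀ᵐ x ∂ν, x ∈ {x : Fin k → Eucl n | Function.Injective x} := by
    refine Measure.ae_smul_measure ?_ _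
    have : ∀ᵐ x : Fin k → Eucl n, ∀ a b, a ≠ b → x a ≠ x b := by
      simp only [eventually_all]
      intro a b hab
      rw [ae_iff]
      simpa using volume_setOf_apply_eq hn hab
    filter_upwards [this] with x hx a b hab
    by_contra hne
    exact hx a b hne hab
  rw [← Measure.restrict_eq_self_of_ae_mem hMae, hrestr, Measure.restrict_eq_self_of_ae_mem hνae]

end IsStationaryPoissonProcess

/-! ### The marked process of germs and grains. -/

namespace IsStationaryBooleanModel

variable {n : ℕ} {Ω : Type*} [MeasurableSpace Ω] {P : Measure Ω} {γ : ℝ}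
  {Q : Measure (ConvexBody (Eucl n))} {ξ : ℕ → Ω → Eucl n} {G : ℕ → Ω → ConvexBody (Eucl n)}

theorem measurable_tuple (hZ : IsStationaryBooleanModel P γ Q ξ G) {k : ℕ} (i : Fin k → ℕ) :
    Measurable fun ω => ((fun j => ξ (i j) ω, fun j => G (i j) ω) :
      (Fin k → Eucl n) × (Fin k → ConvexBody (Eucl n))) :=
  (hZ.germs.measurable_tuple i).prodMk
    (measurable_pi_lambda _ fun j => hZ.grain_measurable (i j))

variable [IsProbabilityMeasure P]

/-- The factorial moment measures of the marked Poisson process. -/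
theorem sum_map_tuple (hZ : IsStationaryBooleanModel P γ Q ξ G) (hn : n ≠ 0) (k : ℕ) :
    Measure.sum (fun i : Fin k ↪ ℕ => P.map fun ω => ((fun j => ξ (i j) ω, fun j => G (i j) ω) :
      (Fin k → Eucl n) × (Fin k → ConvexBody (Eucl n)))) =
      (ENNReal.ofReal γ ^ k • (volume : Measure (Fin k → Eucl n))).prod
        (Measure.pi fun _ => Q) := by
  have := hZ.grainDistribution.isProbabilityMeasure
  rw [← hZ.germs.sum_map_tuple hn k, Measure.prod_sum_left]
  congr 1
  ext1 i
  have hind : IndepFun (fun ω j => ξ (i j) ω) (fun ω j => G (i j) ω) P :=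
    hZ.germs_grains_indep.comp (φ := fun x : ℕ → Eucl n => fun j => x (i j))
      (ψ := fun K : ℕ → ConvexBody (Eucl n) => fun j => K (i j)) (by fun_prop) (by fun_prop)
  rw [(indepFun_iff_map_prod_eq_prod_map_map (hZ.germs.measurable_tuple i).aemeasurable
    (measurable_pi_lambda _ fun j => hZ.grain_measurable (i j)).aemeasurable).1 hind]
  congr 1
  -- Since `i` is injective, the grains along it are independent, so their joint law is `Q^k`
  -- whatever `i` is.
  have := (iIndepFun_iff_map_fun_eq_pi_map
    fun j => (hZ.grain_measurable (i j)).aemeasurable).1 (hZ.grain_indep.precomp i.injective)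
  simpa only [Function.comp_apply, hZ.grain_law] using! this

end IsStationaryBooleanModel

/-! ### Measurability and bounds for intersections of translates. -/

section

variable {n : ℕ}

theorem isConvexCompact_translateInter {k : ℕ} (K₀ : ConvexBody (Eucl n))
    (K : Fin k → ConvexBody (Eucl n)) (x : Fin k → Eucl n) :
    IsConvexCompact (translateInter K₀ K x) :=
  K₀.isConvexCompact.inter_isClosed (convex_iInter fun i => (K i).convex.vadd _)
    (isClosed_iInter fun i => (K i).isClosed.vadd _)

/-- The set is a projection along the compact factor `K₀` of a closed incidence relation, and such a
projection is a closed map. -/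
theorem isClosed_setOf_translateInter_inter_nonempty {k : ℕ} (K₀ : ConvexBody (Eucl n))
    {F : Set (Eucl n)} (hF : IsClosed F) :
    IsClosed {p : (Fin k → Eucl n) × (Fin k → ConvexBody (Eucl n)) |
      (translateInter K₀ p.2 p.1 ∩ F).Nonempty} := by
  have : CompactSpace (K₀ : Set (Eucl n)) := isCompact_iff_compactSpace.1 K₀.isCompact
  have h : IsClosed {q : ↥(K₀ : Set (Eucl n)) ×
      ((Fin k → Eucl n) × (Fin k → ConvexBody (Eucl n))) |
      (q.1 : Eucl n) ∈ F ∧ ∀ j, (q.1 : Eucl n) - q.2.1 j ∈ q.2.2 j} := by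
    rw [ofPred_and, ofPred_forall]
    refine (hF.preimage (by fun_prop)).inter (isClosed_iInter fun j => ?_)
    exact ConvexBody.isClosed_setOf_mem.preimage
      (f := fun q : ↥(K₀ : Set (Eucl n)) × ((Fin k → Eucl n) × (Fin k → ConvexBody (Eucl n))) =>
        ((q.1 : Eucl n) - q.2.1 j, q.2.2 j)) (by fun_prop)
  convert isClosedMap_snd_of_compactSpace _ h using 1
  ext ⟨x, K⟩
  simp only [translateInter, mem_ofPred_eq, mem_image, Prod.exists, Subtype.exists]
  constructor
  · rintro ⟨a, ⟨ha, hax⟩, haF⟩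
    refine ⟨a, ha, x, K, ⟨haF, fun j => ?_⟩, rfl⟩
    have := mem_vadd_set_iff_neg_vadd_mem.1 (mem_iInter.1 hax j)
    rwa [vadd_eq_add, neg_add_eq_sub] at this
  · rintro ⟨a, ha, x', K', ⟨haF, haj⟩, h⟩
    obtain ⟨rfl, rfl⟩ := Prod.mk.inj h
    refine ⟨a, ⟨ha, mem_iInter.2 fun j => mem_vadd_set_iff_neg_vadd_mem.2 ?_⟩, haF⟩
    rw [vadd_eq_add, neg_add_eq_sub]
    exact haj j

theorem IsAdditiveExtension.measurable_translateInter {φ : ConvexBody (Eucl n) → ℝ} (hφ : IsVal φ)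
    {ψ : Set (Eucl n) → ℝ} (hψ : IsAdditiveExtension φ ψ) (k : ℕ) (K₀ : ConvexBody (Eucl n)) :
    Measurable fun p : (Fin k → Eucl n) × (Fin k → ConvexBody (Eucl n)) =>
      ψ (translateInter K₀ p.2 p.1) := by
  classical
  set D := {p : (Fin k → Eucl n) × (Fin k → ConvexBody (Eucl n)) |
    (translateInter K₀ p.2 p.1).Nonempty} with hDdef
  have hD : MeasurableSet D := by
    have := isClosed_setOf_translateInter_inter_nonempty (k := k) K₀ isClosed_univ
    simp only [inter_univ] at this
    exact this.measurableSet
  -- The value `K₀` off `D` is arbitrary: the indicator of `D` removes it below.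
  let f : (Fin k → Eucl n) × (Fin k → ConvexBody (Eucl n)) → ConvexBody (Eucl n) := fun p =>
    if h : (translateInter K₀ p.2 p.1).Nonempty then
      ⟨_, (isConvexCompact_translateInter K₀ p.2 p.1).1,
        (isConvexCompact_translateInter K₀ p.2 p.1).2, h⟩ else K₀
  have hfD : ∀ p ∈ D, (f p : Set (Eucl n)) = translateInter K₀ p.2 p.1 := fun p hp => by
    simp only [f]
    rw [dif_pos (show (translateInter K₀ p.2 p.1).Nonempty from hp)]
    rfl
  have hfD' : ∀ p ∉ D, f p = K₀ := fun p hp => dif_neg hp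
  have hf : Measurable f := by
    refine ConvexBody.measurable_of_hit_closed fun F hF => ?_
    have : {p | ((f p : Set (Eucl n)) ∩ F).Nonempty} =
        (D ∩ {p | (translateInter K₀ p.2 p.1 ∩ F).Nonempty}) ∪
        (Dᶜ ∩ {_p | ((K₀ : Set (Eucl n)) ∩ F).Nonempty}) := by
      ext p
      by_cases hp : p ∈ D
      · simp [hp, hfD p hp]
      · simp [hp, hfD' p hp]
    rw [this]
    exact (hD.inter (isClosed_setOf_translateInter_inter_nonempty K₀ hF).measurableSet).union
      (hD.compl.inter (MeasurableSet.const _))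
  have : (fun p : (Fin k → Eucl n) × (Fin k → ConvexBody (Eucl n)) =>
      ψ (translateInter K₀ p.2 p.1)) = D.indicator fun p => φ (f p) := by
    ext p
    by_cases hp : p ∈ D
    · rw [indicator_of_mem hp, ← hψ.eq_on_bodies, hfD p hp]
    · rw [indicator_of_notMem hp, not_nonempty_iff_eq_empty.1 hp, hψ.empty]
  rw [this]
  exact (hφ.continuous.measurable.comp hf).indicator hD

/-- The pairs `(x, K)` such that `K + x` hits `K₀`. -/
def hitSet (K₀ : ConvexBody (Eucl n)) : Set (Eucl n × ConvexBody (Eucl n)) :=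
  {p | ((K₀ : Set (Eucl n)) ∩ (p.1 +ᵥ (p.2 : Set (Eucl n)))).Nonempty}

theorem isClosed_hitSet (K₀ : ConvexBody (Eucl n)) : IsClosed (hitSet K₀) := by
  have := (isClosed_setOf_translateInter_inter_nonempty (k := 1) K₀ isClosed_univ).preimage
    (f := fun p : Eucl n × ConvexBody (Eucl n) => (fun _ => p.1, fun _ => p.2)) (by fun_prop)
  simpa [translateInter, iInter_const] using! this

theorem mem_hitSet_of_translateInter_nonempty {k : ℕ} {K₀ : ConvexBody (Eucl n)}
    {K : Fin k → ConvexBody (Eucl n)} {x : Fin k → Eucl n}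
    (h : (translateInter K₀ K x).Nonempty) (j : Fin k) : (x j, K j) ∈ hitSet K₀ :=
  h.mono (inter_subset_inter_right _ (iInter_subset _ j))

/-- The tuples all of whose members hit `K₀`. -/
def tupleHitSet (k : ℕ) (K₀ : ConvexBody (Eucl n)) :
    Set ((Fin k → Eucl n) × (Fin k → ConvexBody (Eucl n))) :=
  {p | ∀ j, (p.1 j, p.2 j) ∈ hitSet K₀}

theorem measurableSet_tupleHitSet (k : ℕ) (K₀ : ConvexBody (Eucl n)) :
    MeasurableSet (tupleHitSet k K₀) := by
  rw [tupleHitSet, ofPred_forall]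
  exact MeasurableSet.iInter fun j => ((isClosed_hitSet K₀).preimage
    (f := fun p : (Fin k → Eucl n) × (Fin k → ConvexBody (Eucl n)) => (p.1 j, p.2 j))
    (by fun_prop)).measurableSet

/-- All the intersections lie in `K₀`, so one bound serves every `k`. This uniformity is what makes
the series converge. -/
theorem IsAdditiveExtension.exists_enorm_translateInter_le {φ : ConvexBody (Eucl n) → ℝ}
    (hφ : IsVal φ) {ψ : Set (Eucl n) → ℝ} (hψ : IsAdditiveExtension φ ψ)
    (K₀ : ConvexBody (Eucl n)) : ∃ C : ℝ≥0∞, C ≠ ⊤ ∧ ∀ (k : ℕ)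
      (p : (Fin k → Eucl n) × (Fin k → ConvexBody (Eucl n))),
      ‖ψ (translateInter K₀ p.2 p.1)‖ₑ ≤ (tupleHitSet k K₀).indicator (fun _ => C) p := by
  obtain ⟨C, hC, hb⟩ := ConvexBody.exists_bound_of_continuous hφ.continuous K₀.isCompact
  refine ⟨ENNReal.ofReal C, ENNReal.ofReal_ne_top, fun k p => ?_⟩
  rcases (translateInter K₀ p.2 p.1).eq_empty_or_nonempty with h | h
  · simp [h, hψ.empty]
  · rw [indicator_of_mem (show p ∈ tupleHitSet k K₀ from
      fun j => mem_hitSet_of_translateInter_nonempty h j)]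
    obtain ⟨L, hL⟩ := (isConvexCompact_translateInter K₀ p.2 p.1).exists_body h
    rw [← hL, hψ.eq_on_bodies, ← ofReal_norm]
    exact ENNReal.ofReal_le_ofReal (hb L (hL ▸ inter_subset_left))

/-- Cover `K₀` by `m` unit balls. If `K + x` meets the ball around `c`, then `c - x` lies in `K +
B`, a set of translations with the volume of `K + B`. -/
theorem measure_hitSet_le (K₀ : ConvexBody (Eucl n)) : ∃ m : ℕ, ∀ K : ConvexBody (Eucl n),
    volume {x | (x, K) ∈ hitSet K₀} ≤
      m * volume ((K : Set (Eucl n)) + Metric.closedBall (0 : Eucl n) 1) := by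
  obtain ⟨t, -, htf, ht⟩ := K₀.isCompact.finite_cover_balls one_pos
  lift t to Finset (Eucl n) using htf
  refine ⟨t.card, fun K => ?_⟩
  have hcl : IsClosed ((K : Set (Eucl n)) + Metric.closedBall (0 : Eucl n) 1) :=
    (K.isCompact.add (isCompact_closedBall _ _)).isClosed
  have hsub : {x | (x, K) ∈ hitSet K₀} ⊆ ⋃ c ∈ t, (fun x => c - x) ⁻¹'
      ((K : Set (Eucl n)) + Metric.closedBall (0 : Eucl n) 1) := by
    rintro x ⟨a, ha, hax⟩
    obtain ⟨c, hc, hac⟩ := mem_iUnion₂.1 (ht ha)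
    have hmem := mem_vadd_set_iff_neg_vadd_mem.1 hax
    refine mem_iUnion₂.2 ⟨c, hc, -x + a, hmem, c - a, ?_, by simp; abel⟩
    rw [mem_closedBall_zero_iff, ← dist_eq_norm, dist_comm]
    exact (Metric.mem_ball.1 hac).le
  calc volume {x | (x, K) ∈ hitSet K₀}
      ≤ ∑ c ∈ t, volume ((fun x => c - x) ⁻¹'
        ((K : Set (Eucl n)) + Metric.closedBall (0 : Eucl n) 1)) :=
        (measure_mono hsub).trans (measure_biUnion_finset_le _ _)
    _ = _ := by
        simp only [(Measure.measurePreserving_sub_left volume _).measure_preimage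
          hcl.measurableSet.nullMeasurableSet, Finset.sum_const, nsmul_eq_mul]

theorem volume_section_tupleHitSet {k : ℕ} (K₀ : ConvexBody (Eucl n))
    (K : Fin k → ConvexBody (Eucl n)) :
    volume {x | (x, K) ∈ tupleHitSet k K₀} = ∏ j, volume {x | (x, K j) ∈ hitSet K₀} := by
  rw [← volume_pi_pi]
  congr 1
  ext x
  simp [tupleHitSet]

theorem measurable_volume_section_hitSet (K₀ : ConvexBody (Eucl n)) :
    Measurable fun K => volume {x | (x, K) ∈ hitSet K₀} :=
  measurable_measure_prodMk_right (isClosed_hitSet K₀).measurableSet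

theorem volume_section_hitSet_lt_top (K₀ K : ConvexBody (Eucl n)) :
    volume {x | (x, K) ∈ hitSet K₀} < ⊤ := by
  obtain ⟨m, hm⟩ := measure_hitSet_le K₀
  exact (hm K).trans_lt (ENNReal.mul_lt_top (ENNReal.natCast_lt_top m)
    (K.isCompact.add (isCompact_closedBall _ _)).measure_lt_top)

theorem IsGrainDistribution.lintegral_hitSet_lt_top {Q : Measure (ConvexBody (Eucl n))}
    (hQ : IsGrainDistribution Q) (K₀ : ConvexBody (Eucl n)) :
    ∫⁻ K, volume {x | (x, K) ∈ hitSet K₀} ∂Q < ⊤ := by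
  obtain ⟨m, hm⟩ := measure_hitSet_le K₀
  refine (lintegral_mono hm).trans_lt ?_
  rw [lintegral_const_mul' _ _ (ENNReal.natCast_ne_top m)]
  exact ENNReal.mul_lt_top (ENNReal.natCast_lt_top m) hQ.volume_finite

/-- For fixed bodies the admissible translations form a product set. Integrating its volume over
independent bodies gives a power. -/
theorem measure_prod_tupleHitSet {Q : Measure (ConvexBody (Eucl n))} [IsProbabilityMeasure Q]
    (k : ℕ) (K₀ : ConvexBody (Eucl n)) :
    (volume : Measure (Fin k → Eucl n)).prod (Measure.pi fun _ => Q) (tupleHitSet k K₀) =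
      (∫⁻ K, volume {x | (x, K) ∈ hitSet K₀} ∂Q) ^ k := by
  rw [Measure.prod_apply_symm (measurableSet_tupleHitSet k K₀)]
  have : ∀ K : Fin k → ConvexBody (Eucl n), volume ((fun x => (x, K)) ⁻¹' tupleHitSet k K₀) =
      ∏ j, volume {x | (x, K j) ∈ hitSet K₀} := volume_section_tupleHitSet K₀
  simp only [this]
  have hind := iIndepFun_pi (μ := fun _ : Fin k => Q)
    (X := fun _ K => volume {x | (x, K) ∈ hitSet K₀})
    fun _ => (measurable_volume_section_hitSet K₀).aemeasurable
  rw [lintegral_prod_eq_prod_lintegral_of_indepFun Finset.univ _ hind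
    fun j => (measurable_volume_section_hitSet K₀).comp (measurable_pi_apply j)]
  have hev : ∀ j : Fin k, ∫⁻ K : Fin k → ConvexBody (Eucl n),
      volume {x | (x, K j) ∈ hitSet K₀} ∂(Measure.pi fun _ => Q) =
      ∫⁻ K, volume {x | (x, K) ∈ hitSet K₀} ∂Q := fun j =>
    (measurePreserving_eval (fun _ : Fin k => Q) j).lintegral_comp
      (measurable_volume_section_hitSet K₀)
  simp only [hev, Finset.prod_const, Finset.card_univ, Fintype.card_fin]

end

/-! ### From index sets to injective tuples, and the pathwise expansion. -/

/-- The embeddings with a prescribed image are the enumerations of the image. -/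
noncomputable def embeddingsWithImageEquiv {k : ℕ} (t : Finset ℕ) :
    {i : Fin k ↪ ℕ // Finset.univ.map i = t} ≃ (Fin k ≃ t) where
  toFun i := Equiv.ofBijective
    (fun j => ⟨i.1 j, i.2.subset (Finset.mem_map_of_mem i.1 (Finset.mem_univ j))⟩)
    ⟨fun a b h => i.1.injective (congrArg Subtype.val h), fun ⟨m, hm⟩ => by
      obtain ⟨j, -, hj⟩ := Finset.mem_map.1 (i.2.symm.subset hm)
      exact ⟨j, Subtype.ext hj⟩⟩
  invFun e := ⟨e.toEmbedding.trans (Function.Embedding.subtype _), by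
    ext m
    simp only [Finset.mem_map, Finset.mem_univ, true_and]
    constructor
    · rintro ⟨j, rfl⟩
      exact (e j).2
    · intro hm
      exact ⟨e.symm ⟨m, hm⟩, by simp⟩⟩
  left_inv i := by
    ext j
    rfl
  right_inv e := by
    ext j
    rfl

/-- Each `k`-element set is the image of exactly `k!` embeddings. Only the finitely many subsets of
`s` contribute. -/
theorem hasSum_embeddings_map {g : Finset ℕ → ℝ} {s : Finset ℕ} (hg : ∀ t, ¬t ⊆ s → g t = 0)
    (k : ℕ) : HasSum (fun i : Fin k ↪ ℕ => g (Finset.univ.map i))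
      (k.factorial * ∑ t ∈ s.powersetCard k, g t) := by
  classical
  have hfin : ∀ t : Finset ℕ, Finite {i : Fin k ↪ ℕ // Finset.univ.map i = t} := fun t =>
    Finite.of_equiv _ (embeddingsWithImageEquiv t).symm
  rw [← (Equiv.sigmaFiberEquiv fun i : Fin k ↪ ℕ => Finset.univ.map i).hasSum_iff]
  have hval : ∀ p : Σ t : Finset ℕ, {i : Fin k ↪ ℕ // Finset.univ.map i = t},
      ((fun i : Fin k ↪ ℕ => g (Finset.univ.map i)) ∘
        (Equiv.sigmaFiberEquiv fun i : Fin k ↪ ℕ => Finset.univ.map i)) p = g p.1 := by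
    rintro ⟨t, i, rfl⟩
    rfl
  rw [show ((fun i : Fin k ↪ ℕ => g (Finset.univ.map i)) ∘
        (Equiv.sigmaFiberEquiv fun i : Fin k ↪ ℕ => Finset.univ.map i)) = _ from funext hval]
  have hempty : ∀ t : Finset ℕ, t.card ≠ k →
      IsEmpty {i : Fin k ↪ ℕ // Finset.univ.map i = t} := fun t ht =>
    ⟨fun i => ht (by rw [← i.2, Finset.card_map, Finset.card_univ, Fintype.card_fin])⟩
  have hinner : ∀ t : Finset ℕ, HasSum (fun _ : {i : Fin k ↪ ℕ // Finset.univ.map i = t} => g t)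
      (if t ∈ s.powersetCard k then k.factorial * g t else 0) := by
    intro t
    have := Fintype.ofFinite {i : Fin k ↪ ℕ // Finset.univ.map i = t}
    convert hasSum_fintype (fun _ : {i : Fin k ↪ ℕ // Finset.univ.map i = t} => g t) using 1
    rw [Finset.sum_const, nsmul_eq_mul, Finset.card_univ]
    split_ifs with ht
    · have hc : Fintype.card (Fin k) = Fintype.card t := by
        rw [Fintype.card_fin, Fintype.card_coe, (Finset.mem_powersetCard.1 ht).2]
      rw [Fintype.card_congr (embeddingsWithImageEquiv t),
        Fintype.card_equiv (Fintype.equivOfCardEq hc), Fintype.card_fin]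
    · by_cases hts : t ⊆ s
      · have := hempty t fun h => ht (Finset.mem_powersetCard.2 ⟨hts, h⟩)
        simp
      · rw [hg t hts, mul_zero]
  have houter := hasSum_sum_of_ne_finset_zero (L := SummationFilter.unconditional _) (s := s.powersetCard k)
    (f := fun t => if t ∈ s.powersetCard k then k.factorial * g t else 0) fun t ht => if_neg ht
  have hsum : ∑ t ∈ s.powersetCard k, (if t ∈ s.powersetCard k then k.factorial * g t else 0) =
      k.factorial * ∑ t ∈ s.powersetCard k, g t := by
    rw [Finset.mul_sum]
    exact Finset.sum_congr rfl fun t ht => if_pos ht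
  rw [hsum] at houter
  refine houter.sigma_of_hasSum hinner ?_
  refine summable_of_hasFiniteSupport ?_
  refine ((Finset.finite_toSet (s.powerset.sigma fun t =>
    @Finset.univ _ (Fintype.ofFinite {i : Fin k ↪ ℕ // Finset.univ.map i = t})))).subset ?_
  rintro ⟨t, i⟩ hp
  simp only [Finset.coe_sigma, mem_sigma_iff, Finset.mem_coe, Finset.mem_powerset,
    Finset.mem_univ, and_true]
  by_contra h
  exact hp (hg t h)

theorem translateInter_comp_embedding {n k : ℕ} (K₀ : ConvexBody (Eucl n)) (x : ℕ → Eucl n)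
    (K : ℕ → ConvexBody (Eucl n)) (i : Fin (k + 1) ↪ ℕ) :
    translateInter K₀ (fun j => K (i j)) (fun j => x (i j)) =
      ⋂ m ∈ Finset.univ.map i, ((K₀ : Set (Eucl n)) ∩ (x m +ᵥ (K m : Set (Eucl n)))) := by
  rw [translateInter, inter_iInter]
  ext a
  simp

/-- The inclusion-exclusion formula for the part of a locally finite union of convex bodies in a
convex body. -/
theorem IsAdditiveExtension.hasSum_iUnion_inter {n : ℕ} {φ : ConvexBody (Eucl n) → ℝ}
    (hφ : IsVal φ) {ψ : Set (Eucl n) → ℝ} (hψ : IsAdditiveExtension φ ψ)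
    (K₀ : ConvexBody (Eucl n)) (x : ℕ → Eucl n) (K : ℕ → ConvexBody (Eucl n))
    (hfin : {i | (x i, K i) ∈ hitSet K₀}.Finite) :
    IsPolyconvex ((⋃ i, (x i +ᵥ (K i : Set (Eucl n)))) ∩ (K₀ : Set (Eucl n))) ∧
    HasSum (fun p : Σ k : ℕ, (Fin (k + 1) ↪ ℕ) =>
      (-1 : ℝ) ^ p.1 / ((p.1 + 1).factorial : ℝ) *
        ψ (translateInter K₀ (fun j => K (p.2 j)) (fun j => x (p.2 j))))
      (ψ ((⋃ i, (x i +ᵥ (K i : Set (Eucl n)))) ∩ (K₀ : Set (Eucl n)))) := by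
  classical
  set C : ℕ → Set (Eucl n) := fun m => (K₀ : Set (Eucl n)) ∩ (x m +ᵥ (K m : Set (Eucl n))) with hC
  have hCC : ∀ m, IsConvexCompact (C m) := fun m =>
    K₀.isConvexCompact.inter_isClosed ((K m).convex.vadd _) ((K m).isClosed.vadd _)
  set s : Finset ℕ := hfin.toFinset with hs
  have hempty : ∀ m, m ∉ s → C m = ∅ := fun m hm =>
    not_nonempty_iff_eq_empty.1 fun h => hm (hfin.mem_toFinset.2 h)
  have hU : (⋃ i, (x i +ᵥ (K i : Set (Eucl n)))) ∩ (K₀ : Set (Eucl n)) = ⋃ m ∈ s, C m := by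
    rw [inter_comm, inter_iUnion]
    ext a
    simp only [mem_iUnion, exists_prop]
    refine ⟨fun ⟨m, hm⟩ => ⟨m, ?_, hm⟩, fun ⟨m, _, hm⟩ => ⟨m, hm⟩⟩
    by_contra h
    exact (hempty m h ▸ hm : a ∈ (∅ : Set (Eucl n)))
  rw [hU]
  refine ⟨IsPolyconvex.biUnion s hCC, ?_⟩
  set g : Finset ℕ → ℝ := fun t => ψ (⋂ m ∈ t, C m) with hgdef
  have hg : ∀ t, ¬t ⊆ s → g t = 0 := by
    intro t ht
    obtain ⟨m, hmt, hms⟩ := Finset.not_subset.1 ht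
    have : ⋂ m ∈ t, C m = ∅ :=
      subset_empty_iff.1 ((biInter_subset_of_mem hmt).trans (hempty m hms).subset)
    rw [hgdef]
    simp only [this, hψ.empty]
  simp only [translateInter_comp_embedding]
  have hinner : ∀ k, HasSum (fun i : Fin (k + 1) ↪ ℕ =>
      (-1 : ℝ) ^ k / ((k + 1).factorial : ℝ) * g (Finset.univ.map i))
      ((-1 : ℝ) ^ k * ∑ t ∈ s.powersetCard (k + 1), g t) := by
    intro k
    have := (hasSum_embeddings_map hg (k + 1)).mul_left ((-1 : ℝ) ^ k / ((k + 1).factorial : ℝ))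
    rwa [← mul_assoc, div_mul_cancel₀ _ (by positivity)] at this
  have houter : HasSum (fun k : ℕ => (-1 : ℝ) ^ k * ∑ t ∈ s.powersetCard (k + 1), g t)
      (ψ (⋃ m ∈ s, C m)) := by
    have h1 := hasSum_sum_of_ne_finset_zero (L := SummationFilter.unconditional _) (s := Finset.range s.card)
      (f := fun k : ℕ => (-1 : ℝ) ^ k * ∑ t ∈ s.powersetCard (k + 1), g t) fun k hk => by
        rw [Finset.powersetCard_eq_empty.2 (Nat.lt_succ_of_le (not_lt.1 (Finset.mem_range.not.1 hk))),
          Finset.sum_empty, mul_zero]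
    convert h1 using 1
    rw [hψ.biUnion_eq_sum hφ s hCC, Finset.sum_filter, Finset.sum_powerset, Finset.sum_range_succ',
      Finset.powersetCard_zero, Finset.sum_singleton, if_neg Finset.not_nonempty_empty, add_zero]
    refine Finset.sum_congr rfl fun k _ => ?_
    rw [Finset.mul_sum]
    refine Finset.sum_congr rfl fun t ht => ?_
    have hcard := (Finset.mem_powersetCard.1 ht).2
    -- The index `k` stands for sets of size `k + 1`, whose sign `(-1)^(k+2)` equals `(-1)^k`.
    rw [if_pos (Finset.card_pos.1 (by omega)), hcard, pow_add, pow_add]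
    simp [hgdef]
  refine houter.sigma_of_hasSum hinner ?_
  refine summable_of_hasFiniteSupport ?_
  -- Merging the two sums needs summability of the whole family. Its support is finite: the tuples
  -- take values in `s`, hence have length at most `s.card`.
  have hfinE : ∀ k, Finite {i : Fin (k + 1) ↪ ℕ // ∀ j, i j ∈ s} := fun k =>
    Finite.of_injective (fun i j => (⟨i.1 j, i.2 j⟩ : s) :
      {i : Fin (k + 1) ↪ ℕ // ∀ j, i j ∈ s} → (Fin (k + 1) → s)) fun a b hab => by
        ext j
        exact congrArg Subtype.val (congrFun hab j)
  have hF : (⋃ k ∈ Finset.range s.card, (fun i : {i : Fin (k + 1) ↪ ℕ // ∀ j, i j ∈ s} =>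
      (⟨k, i.1⟩ : Σ k : ℕ, (Fin (k + 1) ↪ ℕ))) '' univ).Finite :=
    (Finset.finite_toSet _).biUnion fun k _ => finite_univ.image _
  refine hF.subset ?_
  rintro ⟨k, i⟩ hp
  have hsub : Finset.univ.map i ⊆ s := by
    by_contra h
    exact hp ((congrArg _ (hg _ h)).trans (mul_zero _))
  have hi : ∀ j, i j ∈ s := fun j => hsub (Finset.mem_map_of_mem i (Finset.mem_univ j))
  refine mem_iUnion₂.2 ⟨k, Finset.mem_range.2 ?_, ⟨i, hi⟩, mem_univ _, rfl⟩
  have := Finset.card_le_card hsub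
  rw [Finset.card_map, Finset.card_univ, Fintype.card_fin] at this
  exact this

/-! ### Taking expectations. -/

namespace IsStationaryBooleanModel

variable {n : ℕ} {Ω : Type*} [MeasurableSpace Ω] {P : Measure Ω} [IsProbabilityMeasure P] {γ : ℝ}
  {Q : Measure (ConvexBody (Eucl n))} {ξ : ℕ → Ω → Eucl n} {G : ℕ → Ω → ConvexBody (Eucl n)}

/-- Campbell's formula for injective tuples of the marked process. -/
theorem tsum_lintegral_tuple (hZ : IsStationaryBooleanModel P γ Q ξ G) (hn : n ≠ 0) (k : ℕ)
    {f : (Fin k → Eucl n) × (Fin k → ConvexBody (Eucl n)) → ℝ≥0∞} (hf : Measurable f) :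
    ∑' i : Fin k ↪ ℕ, ∫⁻ ω, f (fun j => ξ (i j) ω, fun j => G (i j) ω) ∂P =
      ENNReal.ofReal γ ^ k * ∫⁻ p, f p ∂((volume : Measure (Fin k → Eucl n)).prod
        (Measure.pi fun _ => Q)) := by
  have := hZ.grainDistribution.isProbabilityMeasure
  rw [← smul_eq_mul, ← lintegral_smul_measure, ← Measure.prod_smul_left, ← hZ.sum_map_tuple hn k,
    lintegral_sum_measure]
  exact tsum_congr fun i => (lintegral_map hf (hZ.measurable_tuple i)).symm

theorem tsum_lintegral_indicator_tupleHitSet (hZ : IsStationaryBooleanModel P γ Q ξ G)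
    (hn : n ≠ 0) (K₀ : ConvexBody (Eucl n)) (C : ℝ≥0∞) (k : ℕ) :
    ∑' i : Fin k ↪ ℕ, ∫⁻ ω, (tupleHitSet k K₀).indicator (fun _ => C)
      (fun j => ξ (i j) ω, fun j => G (i j) ω) ∂P =
      C * (ENNReal.ofReal γ * ∫⁻ K, volume {x | (x, K) ∈ hitSet K₀} ∂Q) ^ k := by
  have := hZ.grainDistribution.isProbabilityMeasure
  rw [hZ.tsum_lintegral_tuple hn k (measurable_const.indicator (measurableSet_tupleHitSet k K₀)),
    lintegral_indicator_const (measurableSet_tupleHitSet k K₀), measure_prod_tupleHitSet, mul_pow]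
  ring

/-- The case `k = 1` of the moment formula makes the hitting probabilities summable, and
Borel-Cantelli applies. -/
theorem ae_finite_hits (hZ : IsStationaryBooleanModel P γ Q ξ G) (hn : n ≠ 0)
    (K₀ : ConvexBody (Eucl n)) : ∀ᵐ ω ∂P, {i | (ξ i ω, G i ω) ∈ hitSet K₀}.Finite := by
  refine ae_finite_setOfPred_mem (s := fun i => {ω | (ξ i ω, G i ω) ∈ hitSet K₀}) ?_
  have h := hZ.tsum_lintegral_indicator_tupleHitSet hn K₀ 1 1
  rw [← (Equiv.uniqueEmbeddingEquivResult (α := Fin 1) (β := ℕ)).symm.tsum_eq] at h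
  have hm : ∀ i, MeasurableSet {ω | (ξ i ω, G i ω) ∈ hitSet K₀} := fun i =>
    ((hZ.germs.measurable i).prodMk (hZ.grain_measurable i)) (isClosed_hitSet K₀).measurableSet
  have hi : ∀ i : ℕ, ∫⁻ ω, (tupleHitSet 1 K₀).indicator (fun _ => (1 : ℝ≥0∞))
      (fun j => ξ ((Equiv.uniqueEmbeddingEquivResult (α := Fin 1) (β := ℕ)).symm i j) ω,
        fun j => G ((Equiv.uniqueEmbeddingEquivResult (α := Fin 1) (β := ℕ)).symm i j) ω) ∂P =
      P {ω | (ξ i ω, G i ω) ∈ hitSet K₀} := by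
    intro i
    rw [← lintegral_indicator_one (hm i)]
    refine lintegral_congr fun ω => ?_
    by_cases hω : (ξ i ω, G i ω) ∈ hitSet K₀
    · rw [indicator_of_mem (show ω ∈ {ω | (ξ i ω, G i ω) ∈ hitSet K₀} from hω)]
      have hmem : (fun _ => ξ i ω, fun _ => G i ω) ∈ tupleHitSet 1 K₀ := fun _ => hω
      exact indicator_of_mem hmem _
    · rw [indicator_of_notMem (show ω ∉ {ω | (ξ i ω, G i ω) ∈ hitSet K₀} from hω)]
      have hnot : (fun _ => ξ i ω, fun _ => G i ω) ∉ tupleHitSet 1 K₀ := fun h' => hω (h' 0)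
      exact indicator_of_notMem hnot _
  simp only [hi] at h
  rw [h, one_mul, pow_one]
  exact ENNReal.mul_ne_top ENNReal.ofReal_ne_top
    (hZ.grainDistribution.lintegral_hitSet_lt_top K₀).ne

end IsStationaryBooleanModel

namespace IsAdditiveExtension

variable {n : ℕ} {φ : ConvexBody (Eucl n) → ℝ} {ψ : Set (Eucl n) → ℝ}

theorem integrable_translateInter_section (hφ : IsVal φ) (hψ : IsAdditiveExtension φ ψ)
    (K₀ : ConvexBody (Eucl n)) {k : ℕ} (K : Fin k → ConvexBody (Eucl n)) :
    Integrable (fun x : Fin k → Eucl n => ψ (translateInter K₀ K x)) volume := by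
  obtain ⟨C, hC, hb⟩ := hψ.exists_enorm_translateInter_le hφ K₀
  have hm := hψ.measurable_translateInter hφ k K₀
  refine ⟨(hm.comp (measurable_id.prodMk measurable_const)).aestronglyMeasurable, ?_⟩
  have hS : MeasurableSet {x : Fin k → Eucl n | (x, K) ∈ tupleHitSet k K₀} :=
    (measurable_id.prodMk measurable_const) (measurableSet_tupleHitSet k K₀)
  calc ∫⁻ x, ‖ψ (translateInter K₀ K x)‖ₑ
      ≤ ∫⁻ x, {x | (x, K) ∈ tupleHitSet k K₀}.indicator (fun _ => C) x :=
        lintegral_mono fun x => hb k (x, K)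
    _ = C * volume {x | (x, K) ∈ tupleHitSet k K₀} := lintegral_indicator_const hS C
    _ < ⊤ := by
        rw [volume_section_tupleHitSet]
        exact ENNReal.mul_lt_top hC.lt_top
          (ENNReal.prod_lt_top fun j _ => volume_section_hitSet_lt_top K₀ (K j))

theorem integrable_translateInter (hφ : IsVal φ) (hψ : IsAdditiveExtension φ ψ)
    {Q : Measure (ConvexBody (Eucl n))} (hQ : IsGrainDistribution Q)
    (K₀ : ConvexBody (Eucl n)) (k : ℕ) :
    Integrable (fun p : (Fin k → Eucl n) × (Fin k → ConvexBody (Eucl n)) =>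
      ψ (translateInter K₀ p.2 p.1))
      ((volume : Measure (Fin k → Eucl n)).prod (Measure.pi fun _ => Q)) := by
  have := hQ.isProbabilityMeasure
  obtain ⟨C, hC, hb⟩ := hψ.exists_enorm_translateInter_le hφ K₀
  refine ⟨(hψ.measurable_translateInter hφ k K₀).aestronglyMeasurable, ?_⟩
  refine (lintegral_mono (hb k)).trans_lt ?_
  rw [lintegral_indicator_const (measurableSet_tupleHitSet k K₀), measure_prod_tupleHitSet]
  exact ENNReal.mul_lt_top hC.lt_top (ENNReal.pow_lt_top (hQ.lintegral_hitSet_lt_top K₀))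

theorem integrable_translativeIntegral (hφ : IsVal φ) (hψ : IsAdditiveExtension φ ψ)
    {Q : Measure (ConvexBody (Eucl n))} (hQ : IsGrainDistribution Q)
    (K₀ : ConvexBody (Eucl n)) (k : ℕ) :
    Integrable (fun K : Fin k → ConvexBody (Eucl n) => translativeIntegral ψ K₀ K)
      (Measure.pi fun _ => Q) := by
  have := hQ.isProbabilityMeasure
  exact (hψ.integrable_translateInter hφ hQ K₀ k).integral_prod_right

variable {Ω : Type*} [MeasurableSpace Ω] {P : Measure Ω} [IsProbabilityMeasure P] {γ : ℝ}
  {Q : Measure (ConvexBody (Eucl n))} {ξ : ℕ → Ω → Eucl n} {G : ℕ → Ω → ConvexBody (Eucl n)}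

/-- An integral against a sum of measures is the sum of the integrals. The summed measure is the
factorial moment measure, and Fubini separates positions from bodies. -/
theorem hasSum_integral_tuple (hφ : IsVal φ) (hψ : IsAdditiveExtension φ ψ)
    (hZ : IsStationaryBooleanModel P γ Q ξ G) (hn : n ≠ 0) (K₀ : ConvexBody (Eucl n)) (k : ℕ) :
    HasSum (fun i : Fin k ↪ ℕ =>
      ∫ ω, ψ (translateInter K₀ (fun j => G (i j) ω) (fun j => ξ (i j) ω)) ∂P)
      (γ ^ k * ∫ K : Fin k → ConvexBody (Eucl n), translativeIntegral ψ K₀ K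
        ∂(Measure.pi fun _ => Q)) := by
  have := hZ.grainDistribution.isProbabilityMeasure
  have hint := hψ.integrable_translateInter hφ hZ.grainDistribution K₀ k
  have hm := hψ.measurable_translateInter hφ k K₀
  have hsum := hZ.sum_map_tuple hn k
  rw [Measure.prod_smul_left] at hsum
  have hint' := hint.smul_measure (c := ENNReal.ofReal γ ^ k)
    (ENNReal.pow_ne_top ENNReal.ofReal_ne_top)
  rw [← hsum] at hint'
  have h := hasSum_integral_measure hint'
  rw [hsum, integral_smul_measure, integral_prod_symm _ hint, ENNReal.toReal_pow,
    ENNReal.toReal_ofReal hZ.germs.intensity_pos.le, smul_eq_mul] at h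
  have hi : ∀ i : Fin k ↪ ℕ, _ = _ := fun i =>
    integral_map (μ := P) (hZ.measurable_tuple i).aemeasurable hm.aestronglyMeasurable
  simp only [hi] at h
  exact h

theorem integrable_and_hasSum_booleanModel (hφ : IsVal φ) (hψ : IsAdditiveExtension φ ψ)
    (hZ : IsStationaryBooleanModel P γ Q ξ G) (hn : n ≠ 0) (K₀ : ConvexBody (Eucl n)) :
    Integrable (fun ω => ψ (booleanModelSet ξ G ω ∩ (K₀ : Set (Eucl n)))) P ∧
      HasSum
        (fun k : ℕ => (-1 : ℝ) ^ k / ((k + 1).factorial : ℝ) * γ ^ (k + 1) *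
          ∫ K : Fin (k + 1) → ConvexBody (Eucl n), translativeIntegral ψ K₀ K
            ∂(Measure.pi fun _ => Q))
        (∫ ω, ψ (booleanModelSet ξ G ω ∩ (K₀ : Set (Eucl n))) ∂P) := by
  obtain ⟨C, hC, hb⟩ := hψ.exists_enorm_translateInter_le hφ K₀
  set a : ℝ≥0∞ := ENNReal.ofReal γ * ∫⁻ K, volume {x | (x, K) ∈ hitSet K₀} ∂Q
  have ha : a ≠ ⊤ := ENNReal.mul_ne_top ENNReal.ofReal_ne_top
    (hZ.grainDistribution.lintegral_hitSet_lt_top K₀).ne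
  let T : (Σ k : ℕ, (Fin (k + 1) ↪ ℕ)) → Ω → ℝ := fun p ω =>
    (-1 : ℝ) ^ p.1 / ((p.1 + 1).factorial : ℝ) *
      ψ (translateInter K₀ (fun j => G (p.2 j) ω) (fun j => ξ (p.2 j) ω))
  have hTm : ∀ p, Measurable (T p) := fun p =>
    ((hψ.measurable_translateInter hφ (p.1 + 1) K₀).comp (hZ.measurable_tuple p.2)).const_mul _
  have hTb : ∀ p ω, ‖T p ω‖ₑ ≤ ENNReal.ofReal (1 / ((p.1 + 1).factorial : ℝ)) *
      (tupleHitSet (p.1 + 1) K₀).indicator (fun _ => C)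
        (fun j => ξ (p.2 j) ω, fun j => G (p.2 j) ω) := by
    intro p ω
    rw [enorm_mul]
    refine mul_le_mul' (le_of_eq ?_) (hb _ (fun j => ξ (p.2 j) ω, fun j => G (p.2 j) ω))
    rw [← ofReal_norm]
    simp
  -- The majorant is `C` times the exponential series of `a` without its constant term.
  have hTsum : ∑' p, ∫⁻ ω, ‖T p ω‖ₑ ∂P ≠ ⊤ := by
    have hle : ∑' p, ∫⁻ ω, ‖T p ω‖ₑ ∂P ≤
        ∑' k : ℕ, C * ENNReal.ofReal (a.toReal ^ (k + 1) / ((k + 1).factorial : ℝ)) := by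
      rw [ENNReal.tsum_sigma' (fun p => ∫⁻ ω, ‖T p ω‖ₑ ∂P)]
      refine ENNReal.tsum_le_tsum fun k => ?_
      calc ∑' i : Fin (k + 1) ↪ ℕ, ∫⁻ ω, ‖T ⟨k, i⟩ ω‖ₑ ∂P
          ≤ ∑' i : Fin (k + 1) ↪ ℕ, ENNReal.ofReal (1 / ((k + 1).factorial : ℝ)) *
            ∫⁻ ω, (tupleHitSet (k + 1) K₀).indicator (fun _ => C)
              (fun j => ξ (i j) ω, fun j => G (i j) ω) ∂P := by
            refine ENNReal.tsum_le_tsum fun i => ?_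
            rw [← lintegral_const_mul' _ _ ENNReal.ofReal_ne_top]
            exact lintegral_mono fun ω => hTb ⟨k, i⟩ ω
        _ = C * ENNReal.ofReal (a.toReal ^ (k + 1) / ((k + 1).factorial : ℝ)) := by
            rw [ENNReal.tsum_mul_left, hZ.tsum_lintegral_indicator_tupleHitSet hn K₀ C (k + 1),
              div_eq_mul_one_div (a.toReal ^ (k + 1)), ENNReal.ofReal_mul (by positivity),
              ENNReal.ofReal_pow ENNReal.toReal_nonneg, ENNReal.ofReal_toReal ha]
            ring
    refine ne_top_of_le_ne_top ?_ hle
    rw [ENNReal.tsum_mul_left]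
    have hs : Summable fun k : ℕ => a.toReal ^ (k + 1) / ((k + 1).factorial : ℝ) :=
      (summable_nat_add_iff 1).2 (Real.summable_pow_div_factorial a.toReal)
    rw [← ENNReal.ofReal_tsum_of_nonneg (fun k => by positivity) hs]
    exact ENNReal.mul_ne_top hC ENNReal.ofReal_ne_top
  have hTi : ∀ p, Integrable (T p) P := fun p =>
    ⟨(hTm p).aestronglyMeasurable, (ENNReal.ne_top_of_tsum_ne_top hTsum p).lt_top⟩
  have hTn : Summable fun p => ∫ ω, ‖T p ω‖ ∂P := by
    simp only [integral_norm_eq_lintegral_enorm (hTm _).aestronglyMeasurable]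
    exact ENNReal.summable_toReal hTsum
  have hae : ∀ᵐ ω ∂P, HasSum (fun p => T p ω)
      (ψ (booleanModelSet ξ G ω ∩ (K₀ : Set (Eucl n)))) := by
    filter_upwards [hZ.ae_finite_hits hn K₀] with ω hω
    exact (hψ.hasSum_iUnion_inter hφ K₀ (fun i => ξ i ω) (fun i => G i ω) hω).2
  have haeq : (fun ω => ∑' p, T p ω) =ᵐ[P]
      fun ω => ψ (booleanModelSet ξ G ω ∩ (K₀ : Set (Eucl n))) :=
    hae.mono fun ω hω => hω.tsum_eq
  constructor
  · refine Integrable.congr ⟨(Measurable.tsum hTm).aestronglyMeasurable, ?_⟩ haeq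
    refine (lintegral_mono fun ω => enorm_tsum_le_tsum_enorm).trans_lt ?_
    rw [lintegral_tsum fun p => (hTm p).enorm.aemeasurable]
    exact hTsum.lt_top
  · have h := hasSum_integral_of_summable_integral_norm hTi hTn
    rw [integral_congr_ae haeq] at h
    -- The unconditional sum over all tuples is regrouped by their length.
    refine h.sigma fun k => ?_
    simp only [T, integral_const_mul]
    rw [mul_assoc]
    exact (hψ.hasSum_integral_tuple hφ hZ hn K₀ (k + 1)).mul_left _

end IsAdditiveExtension

end BooleanModel

theorem mainTheorem4 {n : ℕ} (hn : 2 ≤ n) {Ω : Type*} [MeasurableSpace Ω]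
    (P : Measure Ω) [IsProbabilityMeasure P] (γ : ℝ) (Q : Measure (ConvexBody (Eucl n)))
    (ξ : ℕ → Ω → Eucl n) (G : ℕ → Ω → ConvexBody (Eucl n))
    (hZ : IsStationaryBooleanModel P γ Q ξ G)
    (K₀ : ConvexBody (Eucl n)) (φ : ConvexBody (Eucl n) → ℝ) (hφ : IsVal φ) :
    (∀ᵐ ω ∂P, IsPolyconvex (booleanModelSet ξ G ω ∩ (K₀ : Set (Eucl n)))) ∧
    (∃ ψ : Set (Eucl n) → ℝ, IsAdditiveExtension φ ψ) ∧
    ∀ ψ : Set (Eucl n) → ℝ, IsAdditiveExtension φ ψ →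
      Integrable (fun ω => ψ (booleanModelSet ξ G ω ∩ (K₀ : Set (Eucl n)))) P ∧
      (∀ (k : ℕ) (K : Fin (k + 1) → ConvexBody (Eucl n)),
        Integrable (fun x : Fin (k + 1) → Eucl n => ψ (translateInter K₀ K x)) volume) ∧
      (∀ k : ℕ, Integrable (fun K : Fin (k + 1) → ConvexBody (Eucl n) =>
        translativeIntegral ψ K₀ K) (Measure.pi fun _ => Q)) ∧
      HasSum
        (fun k : ℕ => (-1 : ℝ) ^ k / ((k + 1).factorial : ℝ) * γ ^ (k + 1) *
          ∫ K : Fin (k + 1) → ConvexBody (Eucl n), translativeIntegral ψ K₀ K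
            ∂(Measure.pi fun _ => Q))
        (∫ ω, ψ (booleanModelSet ξ G ω ∩ (K₀ : Set (Eucl n))) ∂P) := by
  have hn0 : n ≠ 0 := by omega
  refine ⟨?_, hφ.exists_isAdditiveExtension, fun ψ hψ => ?_⟩
  · obtain ⟨ψ, hψ⟩ := hφ.exists_isAdditiveExtension
    filter_upwards [hZ.ae_finite_hits hn0 K₀] with ω hω
    exact (hψ.hasSum_iUnion_inter hφ K₀ (fun i => ξ i ω) (fun i => G i ω) hω).1
  · have h := hψ.integrable_and_hasSum_booleanModel hφ hZ hn0 K₀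
    exact ⟨h.1, fun k K => hψ.integrable_translateInter_section hφ K₀ K,
      fun k => hψ.integrable_translativeIntegral hφ hZ.grainDistribution K₀ (k + 1), h.2⟩
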